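/- Fix a real number $q$ with $0<q<1$. Let $\mathbb Y$ be the set of partitions (identified with Young diagrams) and, for $\lambda\in\mathbb Y$, let $|\lambda|$ be its size, $\ell(\lambda)$ its length, $\lambda'$ its conjugate, and $n(\lambda)=\sum_{i\ge1}(i-1)\lambda_i$. Let $\mathrm{Sym}$ be the algebra of symmetric functions over $\mathbb C$ in variables $x_1,x_2,\dots$ For $N\ge \ell(\mu)$ let $$I^A_{\mu\mid N}(x_1,\dots,x_N;q)=\frac{\det\left[\prod_{r=0}^{\mu_i+N-i-1}(x_j-q^{N-1-r})\right]_{i,j=1}^N}{\prod_{1\le i<j\le N}(x_i-x_j)},$$ and $I^A_{\mu\mid N}=0$ for $N<\ell(\mu)$. The interpolation symmetric functions are $I^A_\mu(\,\cdot\,;q):=\lim_{N\to\infty}I^A_{\mu\mid N}(\,\cdot\,;q)\in\mathrm{Sym}$, the limit being taken coefficientwise with degrees bounded (these limits exist). A pair $(c,d)$ of complex numbers is called admissible if either $d=\bar c\in\mathbb C\setminus\mathbb R$, or $c,d$ are nonzero reals of the same sign with $q<c/d<q^{-1}$. For an admissible pair, the Al-Salam--Carlitz symmetric functions are $$\Phi^{ASC}_\lambda(X;q;c,d)=\sum_{\mu\subseteq\lambda}\sigma(\lambda,\mu)\,I^A_\mu(Xc;q),\qquad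 \lambda\in\mathbb Y,$$ where $Xc$ means that every variable $x_i$ is replaced by $cx_i$, $$\sigma(\lambda,\mu)=c^{-|\lambda|}\left(-\frac cd\right)^{|\lambda|-|\mu|}q^{\,n(\mu')-n(\mu)-n(\lambda')+n(\lambda)}\det\left[\frac1{(q;q)_{\lambda_j-j-\mu_k+k}}\right]_{j,k=1}^{\ell(\lambda)},$$ $(q;q)_m=\prod_{k=1}^m(1-q^k)$ for $m\ge0$, and $1/(q;q)_m=0$ for $m<0$. Theorem. Let $(c,d)$ be admissible and write $\Phi_\lambda=\Phi^{ASC}_\lambda(\,\cdot\,;q;c,d)$. Then $\{\Phi_\lambda\}_{\lambda\in\mathbb Y}$ is a basis of $\mathrm{Sym}$ with $\Phi_\emptyset=1$, and it is formally orthogonal: if $\mathbb E:\mathrm{Sym}\to\mathbb C$ is the linear functional with $\mathbb E(\Phi_\lambda)=\delta_{\lambda,\emptyset}$ for all $\lambda$, and $(F,G):=\mathbb E(FG)$, then $$(\Phi_\lambda,\Phi_\mu)=\delta_{\lambda,\mu}\,h_\lambda,\qquad h_\lambda=\frac{q^{2\{n(\lambda)-n(\lambda')\}}}{(cdq)^{|\lambda|}},\qquad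 \lambda,\mu\in\mathbb Y.$$ -/

import Mathlib

open scoped Topology

noncomputable section

namespace ASCSym

/-! ### The algebra of symmetric functions -/

/-- The algebra `Sym` of symmetric functions over `ℂ`: formal power series in the variables
`x₀, x₁, x₂, …` which are invariant under all permutations of the variables and whose
monomials have bounded total degree. -/
def SymFun : Subalgebra ℂ (MvPowerSeries ℕ ℂ) where
  carrier := {f | (∀ π : Equiv.Perm ℕ, MvPowerSeries.renameEquiv ℂ π f = f) ∧
    ∃ D : ℕ, ∀ m : ℕ →₀ ℕ, D < m.degree → MvPowerSeries.coeff m f = 0}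
  mul_mem' := by
    rintro f g ⟨hf, D, hD⟩ ⟨hg, E, hE⟩
    refine ⟨fun π => by rw [map_mul, hf π, hg π], D + E, fun m hm => ?_⟩
    classical
    rw [MvPowerSeries.coeff_mul]
    refine Finset.sum_eq_zero fun p hp => ?_
    have hpm : p.1 + p.2 = m := by simpa using hp
    have hdeg : p.1.degree + p.2.degree = m.degree := by rw [← hpm, map_add]
    by_cases h : D < p.1.degree
    · rw [hD _ h, zero_mul]
    · rw [hE _ (by omega), mul_zero]
  add_mem' := by
    rintro f g ⟨hf, D, hD⟩ ⟨hg, E, hE⟩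
    refine ⟨fun π => by rw [map_add, hf π, hg π], max D E, fun m hm => ?_⟩
    rw [map_add, hD m (lt_of_le_of_lt (le_max_left _ _) hm),
      hE m (lt_of_le_of_lt (le_max_right _ _) hm), add_zero]
  algebraMap_mem' r := by
    classical
    refine ⟨fun π => AlgEquiv.commutes _ r, 0, fun m hm => ?_⟩
    rw [MvPowerSeries.algebraMap_apply, MvPowerSeries.coeff_C, if_neg]
    rintro rfl
    simp at hm

/-- The substitution `F(X) ↦ F(Xc)`, i.e. `xᵢ ↦ c xᵢ` for all `i`. -/
def dilate (c : ℂ) (F : SymFun) : SymFun :=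
  ⟨MvPowerSeries.rescale (fun _ => c) F.1, by
    have hcoeff : ∀ m : ℕ →₀ ℕ, MvPowerSeries.coeff m (MvPowerSeries.rescale (fun _ => c) F.1)
        = c ^ m.degree * MvPowerSeries.coeff m F.1 := by
      intro m
      rw [MvPowerSeries.coeff_rescale, Finsupp.prod, Finset.prod_pow_eq_pow_sum]
      rfl
    obtain ⟨hF, D, hD⟩ := F.2
    refine ⟨fun π => ?_, D, fun m hm => by rw [hcoeff, hD m hm, mul_zero]⟩
    ext m
    have key : ∀ G : MvPowerSeries ℕ ℂ, MvPowerSeries.coeff m (MvPowerSeries.renameEquiv ℂ π G)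
        = MvPowerSeries.coeff (m.embDomain π.symm.toEmbedding) G := by
      intro G
      have hm : (m.embDomain π.symm.toEmbedding).embDomain π.toEmbedding = m := by
        ext i
        have := Finsupp.embDomain_apply_self π.toEmbedding
          (m.embDomain π.symm.toEmbedding) (π.symm i)
        have h2 := Finsupp.embDomain_apply_self π.symm.toEmbedding m i
        simp only [Equiv.coe_toEmbedding, Equiv.apply_symm_apply] at this h2
        rw [this, h2]
      conv_lhs => rw [← hm]
      exact MvPowerSeries.coeff_embDomain_rename π.toEmbedding G _
    have hdeg : (m.embDomain π.symm.toEmbedding).degree = m.degree := by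
      show ∑ i ∈ (m.embDomain π.symm.toEmbedding).support, m.embDomain π.symm.toEmbedding i
        = ∑ i ∈ m.support, m i
      rw [Finsupp.support_embDomain, Finset.sum_map]
      exact Finset.sum_congr rfl fun i _ => Finsupp.embDomain_apply_self _ _ _
    rw [key, hcoeff, hcoeff, hdeg, ← key, hF π]⟩

/-- Convergence `F_N → F` of a sequence of `N`-variate polynomials to a symmetric function:
the degrees are bounded, and the coefficient of every fixed monomial in `F_N` (viewed as a
polynomial in the first `N` of the variables `x₀, x₁, …`) converges to that of `F`. -/
def ConvergesTo (P : (N : ℕ) → MvPolynomial (Fin N) ℂ) (F : SymFun) : Prop :=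
  (∃ D : ℕ, ∀ N, (P N).totalDegree ≤ D) ∧
  ∀ m : ℕ →₀ ℕ, Filter.Tendsto (fun N => MvPolynomial.coeff m (MvPolynomial.rename Fin.val (P N)))
    Filter.atTop (𝓝 (MvPowerSeries.coeff m F.1))

/-- A sequence of polynomials has at most one limit in `Sym`. -/
theorem ConvergesTo.unique {P : (N : ℕ) → MvPolynomial (Fin N) ℂ} {F G : SymFun}
    (hF : ConvergesTo P F) (hG : ConvergesTo P G) : F = G := by
  apply Subtype.ext
  ext m
  exact tendsto_nhds_unique (hF.2 m) (hG.2 m)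

/-- The limit in `Sym` of a sequence of `N`-variate polynomials (meaningful if it exists). -/
def symLim (P : (N : ℕ) → MvPolynomial (Fin N) ℂ) : SymFun :=
  Classical.epsilon (ConvergesTo P)

theorem symLim_eq {P : (N : ℕ) → MvPolynomial (Fin N) ℂ} {F : SymFun}
    (h : ConvergesTo P F) : symLim P = F :=
  (Classical.epsilon_spec (p := ConvergesTo P) ⟨F, h⟩).unique h

/-! ### Quotients of alternants by the Vandermonde determinant -/

/-- `V(x₁, …, x_N) = ∏_{i < j} (xᵢ - xⱼ)`. -/
def vand (N : ℕ) : MvPolynomial (Fin N) ℂ :=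
  ∏ p : Fin N × Fin N with p.1 < p.2, (MvPolynomial.X p.1 - MvPolynomial.X p.2)

/-- The determinant `det[f_i(x_j)]` for univariate polynomials `f_i`. -/
def alternant {N : ℕ} (f : Fin N → Polynomial ℂ) : MvPolynomial (Fin N) ℂ :=
  Matrix.det (Matrix.of fun i j : Fin N => Polynomial.aeval (MvPolynomial.X j) (f i))

/-- The substitution `x_i := x_j`. -/
def identify {N : ℕ} (i j : Fin N) : MvPolynomial (Fin N) ℂ →ₐ[ℂ] MvPolynomial (Fin N) ℂ :=
  MvPolynomial.aeval fun k => if k = i then MvPolynomial.X j else MvPolynomial.X k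

theorem sub_dvd_iff {N : ℕ} (i j : Fin N) (P : MvPolynomial (Fin N) ℂ) :
    (MvPolynomial.X i - MvPolynomial.X j) ∣ P ↔ identify i j P = 0 := by
  constructor
  · rintro ⟨Q, rfl⟩
    rw [map_mul, map_sub]
    simp only [identify, MvPolynomial.aeval_X, if_true]
    by_cases h : j = i <;> simp [h]
  · intro h
    have key : (MvPolynomial.X i - MvPolynomial.X j) ∣ P - identify i j P := by
      clear h
      induction P using MvPolynomial.induction_on with
      | C a => simp [identify]
      | add p q hp hq =>
        rw [map_add, add_sub_add_comm]
        exact dvd_add hp hq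
      | mul_X p k hp =>
        have hk : (MvPolynomial.X i - MvPolynomial.X j : MvPolynomial (Fin N) ℂ) ∣
            MvPolynomial.X k - identify i j (MvPolynomial.X k) := by
          by_cases hki : k = i <;> simp [identify, hki]
        rw [map_mul]
        have : p * MvPolynomial.X k - identify i j p * identify i j (MvPolynomial.X k)
            = (p - identify i j p) * MvPolynomial.X k
              + identify i j p * (MvPolynomial.X k - identify i j (MvPolynomial.X k)) := by ring
        rw [this]
        exact dvd_add (Dvd.dvd.mul_right hp _) (Dvd.dvd.mul_left hk _)
    rwa [h, sub_zero] at key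

theorem vand_dvd_alternant {N : ℕ} (f : Fin N → Polynomial ℂ) : vand N ∣ alternant f := by
  unfold vand
  have hX : ∀ a b : Fin N, (MvPolynomial.X a : MvPolynomial (Fin N) ℂ) - MvPolynomial.X b = 0 →
      a = b := fun a b h => MvPolynomial.X_injective (sub_eq_zero.mp h)
  have hprime : ∀ i j : Fin N, i < j →
      Prime (MvPolynomial.X i - MvPolynomial.X j : MvPolynomial (Fin N) ℂ) := by
    intro i j hij
    refine ⟨fun h => hij.ne (hX _ _ h), fun h => ?_, fun a b h => ?_⟩
    · have := (sub_dvd_iff i j 1).mp h.dvd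
      simp at this
    · rw [sub_dvd_iff, map_mul, mul_eq_zero] at h
      rwa [sub_dvd_iff, sub_dvd_iff]
  apply Finset.prod_dvd_of_isRelPrime
  · rintro ⟨i, j⟩ hij ⟨k, l⟩ hkl hne
    simp only [Finset.coe_filter, Finset.mem_univ, true_and, Set.mem_ofPred_eq] at hij hkl
    show IsRelPrime (MvPolynomial.X i - MvPolynomial.X j : MvPolynomial (Fin N) ℂ)
      (MvPolynomial.X k - MvPolynomial.X l)
    rw [(hprime i j hij).irreducible.isRelPrime_iff_not_dvd, sub_dvd_iff, map_sub]
    simp only [identify, MvPolynomial.aeval_X]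
    intro h
    apply hne
    have h1 : (if k = i then j else k) = (if l = i then j else l) := by
      apply hX
      rw [← h]
      split_ifs <;> rfl
    split_ifs at h1 with h2 h3 h3
    · omega
    · rw [h2, h1]
    · omega
    · omega
  · rintro ⟨i, j⟩ hij
    simp only [Finset.mem_filter, Finset.mem_univ, true_and] at hij
    rw [sub_dvd_iff]
    unfold alternant
    rw [AlgHom.map_det]
    apply Matrix.det_zero_of_column_eq hij.ne
    intro k
    simp only [AlgHom.mapMatrix_apply, Matrix.map_apply, Matrix.of_apply,
      ← Polynomial.aeval_algHom_apply]
    congr 2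
    simp [identify, hij.ne']

/-- The polynomial `det[f_i(x_j)] / V(x₁, …, x_N)`. -/
def alternantQuot {N : ℕ} (f : Fin N → Polynomial ℂ) : MvPolynomial (Fin N) ℂ :=
  (vand_dvd_alternant f).choose

theorem vand_mul_alternantQuot {N : ℕ} (f : Fin N → Polynomial ℂ) :
    vand N * alternantQuot f = alternant f :=
  (vand_dvd_alternant f).choose_spec.symm

/-! ### Interpolation symmetric functions of type A -/

/-- The Newton polynomial `(x | c₀, c₁, …)^m = (x - c₀)(x - c₁)⋯(x - c_{m-1})`. -/
def newton (c : ℕ → ℂ) (m : ℕ) : Polynomial ℂ :=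
  ∏ i ∈ Finset.range m, (Polynomial.X - Polynomial.C (c i))

/-- The length `ℓ(μ)`, the number of nonzero rows. -/
def len (μ : YoungDiagram) : ℕ := μ.colLen 0

/-- The multiparameter Schur polynomial
`s_{μ|N}(x₁, …, x_N | c₀, c₁, …) = det[(x_j | c₀, c₁, …)^{μ_i + N - i}] / V(x)`,
set to be `0` if `ℓ(μ) > N`. (Rows are numbered from `0` here.) -/
def multiSchur (c : ℕ → ℂ) (N : ℕ) (μ : YoungDiagram) : MvPolynomial (Fin N) ℂ :=
  if len μ ≤ N then
    alternantQuot fun i : Fin N => newton c (μ.rowLen i + (N - 1 - (i : ℕ)))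
  else 0

/-- `I^A_{μ|N}(x₁, …, x_N; q) = s_{μ|N}(x₁, …, x_N | q^{N-1}, q^{N-2}, q^{N-3}, …)`. -/
def interpA (q : ℝ) (μ : YoungDiagram) (N : ℕ) : MvPolynomial (Fin N) ℂ :=
  multiSchur (fun i => (q : ℂ) ^ ((N : ℤ) - 1 - (i : ℤ))) N μ

/-- The interpolation symmetric function `I^A_μ(·; q) = lim_{N → ∞} I^A_{μ|N}(·; q)`. -/
def IA (q : ℝ) (μ : YoungDiagram) : SymFun := symLim (interpA q μ)

/-! ### Al-Salam–Carlitz symmetric functions -/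

/-- `n(μ) = ∑_{i ≥ 1} (i - 1) μ_i`. -/
def nStat (μ : YoungDiagram) : ℕ := ∑ i ∈ Finset.range (len μ), i * μ.rowLen i

/-- `1 / (q; q)_m` for an integer `m`, which is `0` for `m < 0`. -/
def invQPoch (q : ℝ) (m : ℤ) : ℂ :=
  if m < 0 then 0 else (∏ k ∈ Finset.range m.toNat, (1 - (q : ℂ) * (q : ℂ) ^ k))⁻¹

/-- The coefficient `σ^{ASC}(λ, μ; q; c, d)`. -/
def sigmaASC (q : ℝ) (c d : ℂ) (lam mu : YoungDiagram) : ℂ :=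
  c ^ (-(lam.card : ℤ)) * (-c / d) ^ ((lam.card : ℤ) - (mu.card : ℤ)) *
  (q : ℂ) ^ ((nStat mu.transpose : ℤ) - nStat mu - nStat lam.transpose + nStat lam) *
  Matrix.det (Matrix.of fun j k : Fin (len lam) =>
    invQPoch q ((lam.rowLen j : ℤ) - (j : ℤ) - (mu.rowLen k : ℤ) + (k : ℤ)))

theorem finite_subdiagrams (lam : YoungDiagram) : {mu : YoungDiagram | mu ≤ lam}.Finite := by
  apply Set.Finite.of_finite_image (f := YoungDiagram.cells)
  · apply (lam.cells.powerset : Finset (Finset (ℕ × ℕ))).finite_toSet.subset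
    rintro _ ⟨mu, hmu, rfl⟩
    simpa using hmu
  · intro a _ b _ h
    exact YoungDiagram.ext h

/-- The finite set of all `μ ⊆ λ`. -/
def subdiagrams (lam : YoungDiagram) : Finset YoungDiagram := (finite_subdiagrams lam).toFinset

/-- The Al-Salam–Carlitz symmetric function
`Φ_λ(X; q; c, d) = ∑_{μ ⊆ λ} σ(λ, μ; q; c, d) I^A_μ(Xc; q)`. -/
def PhiASC (q : ℝ) (c d : ℂ) (lam : YoungDiagram) : SymFun :=
  ∑ mu ∈ subdiagrams lam, sigmaASC q c d lam mu • dilate c (IA q mu)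

/-- Admissible pairs: either `d = c̄` with `c ∉ ℝ`, or `c, d` are nonzero reals of the same
sign with `q < c / d < q⁻¹`. -/
def Admissible (q : ℝ) (c d : ℂ) : Prop :=
  (d = (starRingEnd ℂ) c ∧ c.im ≠ 0) ∨
  ∃ c' d' : ℝ, c = c' ∧ d = d' ∧ ((0 < c' ∧ 0 < d') ∨ (c' < 0 ∧ d' < 0)) ∧
    q < c' / d' ∧ c' / d' < q⁻¹

/-- The moment functional of a basis of `Sym` indexed by partitions: the coefficient of the
basis element with index `∅`. -/
def momentFunctional (b : Module.Basis YoungDiagram ℂ SymFun) : SymFun →ₗ[ℂ] ℂ := b.coord ⊥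

/-- `(F, G) = E(FG)`, where `E` is the moment functional of the basis. -/
def formalInner (b : Module.Basis YoungDiagram ℂ SymFun) (F G : SymFun) : ℂ :=
  momentFunctional b (F * G)

/-- `h_λ^{ASC}(q; c, d) = q^{2(n(λ) - n(λ'))} / (cdq)^{|λ|}`. -/
def hASC (q : ℝ) (c d : ℂ) (lam : YoungDiagram) : ℂ :=
  (q : ℂ) ^ (2 * ((nStat lam : ℤ) - (nStat lam.transpose : ℤ))) / (c * d * (q : ℂ)) ^ lam.card

end ASCSym

end

noncomputable section

namespace ASCSym

/-! ### Young diagrams and strictly decreasing sequences -/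

/-! In `N` variables everything reduces to one variable. Put `t = -c/d`, `y = q^(N-1)` and `p_n =
ascPoly q t y n`. Up to rescaling by `y`, these are the Al-Salam--Carlitz polynomials of the second
kind with parameter `c/d`. They satisfy a three-term recurrence, so Favard's argument gives a formal
functional `L` making them orthogonal (`exists_ascPoly_orthogonal`). Expanding two determinants
shows that the quotients `det[p_{λ_i+N-i}(x_j)] / V` are orthogonal for `F ↦ L^{⊗N}(F V²)`
(`tensorFunctional_alternant_mul`).

The `p_n` are explicit combinations of the Newton polynomials with nodes `q^(N-1), q^(N-2), …`,
which are the ones defining `I^A_{μ|N}`. Cauchy--Binet (`alternantQuot_triangular`) therefore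
expands the quotients in the `I^A_{μ|N}` with minors as coefficients. Apart from a quotient of two
factors `rowRatio`, both tending to 1, these minors do not depend on `N`, and multiplied by
`c^(-|λ|)` they tend to `σ(λ, μ)` (`tendsto_sigma`). The normalized norms equal `c^(2|λ|) h_λ` times
`rowRatio` in the same way.

For the limit, the polynomials are lifted to fixed finite combinations of Schur functions with
convergent coefficients (`CoeffTendsto`). By orthogonality against 1, the normalized functionals
converge on the lifted Al-Salam--Carlitz polynomials. Inverting two unitriangular arrays gives
convergence on Schur functions, which span `Sym` (`span_schur`), hence everywhere. The limit
functional makes the undilated functions `ascFun` orthogonal with norms `h_λ`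
(`exists_limit_functional`). Nonzero norms give linear independence, triangularity gives spanning,
and the limit functional is the coordinate at `∅`. The dilation by `c` is an algebra automorphism
and carries all this over to `Φ_λ`. -/

theorem len_le_iff {lam : YoungDiagram} {i : ℕ} : len lam ≤ i ↔ lam.rowLen i = 0 := by
  have h1 : (i, 0) ∈ lam ↔ i < lam.colLen 0 := YoungDiagram.mem_iff_lt_colLen
  have h2 : (i, 0) ∈ lam ↔ 0 < lam.rowLen i := YoungDiagram.mem_iff_lt_rowLen
  have h3 := h1.symm.trans h2
  unfold len
  omega

theorem rowLen_eq_zero {lam : YoungDiagram} {i : ℕ} (h : len lam ≤ i) : lam.rowLen i = 0 :=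
  len_le_iff.mp h

theorem le_iff_rowLen_le {mu lam : YoungDiagram} :
    mu ≤ lam ↔ ∀ i, mu.rowLen i ≤ lam.rowLen i := by
  constructor
  · intro h i
    by_contra! hlt
    exact lt_irrefl _ (YoungDiagram.mem_iff_lt_rowLen.mp
      (h (YoungDiagram.mem_iff_lt_rowLen.mpr hlt)))
  · rintro h ⟨i, j⟩ hij
    exact YoungDiagram.mem_iff_lt_rowLen.mpr
      ((YoungDiagram.mem_iff_lt_rowLen.mp hij).trans_le (h i))

theorem len_mono {mu lam : YoungDiagram} (h : mu ≤ lam) : len mu ≤ len lam := by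
  rw [len_le_iff]
  have := le_iff_rowLen_le.mp h (len lam)
  rw [rowLen_eq_zero le_rfl] at this
  omega

@[simp] theorem len_bot : len ⊥ = 0 := by
  have h := mt YoungDiagram.mem_iff_lt_colLen.mpr (YoungDiagram.notMem_bot (0, 0))
  exact Nat.eq_zero_of_not_pos h

@[simp] theorem rowLen_bot (i : ℕ) : (⊥ : YoungDiagram).rowLen i = 0 :=
  rowLen_eq_zero (by simp)

theorem mem_subdiagrams {mu lam : YoungDiagram} : mu ∈ subdiagrams lam ↔ mu ≤ lam := by
  simp [subdiagrams]

theorem exists_rowLen_eq (a : ℕ → ℕ) (ha : Antitone a) (N : ℕ) (hN : a N = 0) :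
    ∃ lam : YoungDiagram, len lam ≤ N ∧ ∀ i, lam.rowLen i = a i := by
  let lam : YoungDiagram :=
    { cells := (Finset.range N).sigma (fun i => Finset.range (a i)) |>.map
        (Equiv.sigmaEquivProd ℕ ℕ).toEmbedding
      isLowerSet := by
        rintro ⟨i, j⟩ ⟨i', j'⟩ ⟨h1, h2⟩ h
        simp only [Finset.coe_map, Set.mem_image, SetLike.mem_coe, Finset.mem_sigma,
          Finset.mem_range, Equiv.coe_toEmbedding, Sigma.exists,
          Equiv.sigmaEquivProd_apply, Prod.mk.injEq] at h ⊢
        obtain ⟨x, y, ⟨hx, hy⟩, rfl, rfl⟩ := h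
        exact ⟨i', j', ⟨lt_of_le_of_lt h1 hx, lt_of_le_of_lt h2 (hy.trans_le (ha h1))⟩, rfl, rfl⟩ }
  have hmem : ∀ i j, (i, j) ∈ lam ↔ i < N ∧ j < a i := by
    intro i j
    rw [← YoungDiagram.mem_cells]
    simp [lam]
  have hrow : ∀ i, lam.rowLen i = a i := by
    intro i
    have h : ∀ j, j < lam.rowLen i ↔ i < N ∧ j < a i := fun j => by
      rw [← YoungDiagram.mem_iff_lt_rowLen, hmem]
    have hz : N ≤ i → a i = 0 := fun hi => by have := ha hi; omega
    have h1 := h (lam.rowLen i)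
    have h2 := h (a i)
    by_cases hi : i < N
    · have h3 := h (a i - 1)
      have h4 := h (lam.rowLen i - 1)
      omega
    · have := hz (by omega)
      omega
  exact ⟨lam, len_le_iff.mpr (by rw [hrow, hN]), hrow⟩

theorem card_eq_sum_rowLen (lam : YoungDiagram) {N : ℕ} (hN : len lam ≤ N) :
    lam.card = ∑ i ∈ Finset.range N, lam.rowLen i := by
  have h : ∀ x ∈ lam.cells, x.1 ∈ Finset.range N := by
    rintro ⟨i, j⟩ hx
    have h1 : j < lam.rowLen i := YoungDiagram.mem_iff_lt_rowLen.mp hx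
    by_contra hi
    rw [rowLen_eq_zero (i := i) (by simp at hi; omega)] at h1
    omega
  rw [YoungDiagram.card, Finset.card_eq_sum_card_fiberwise h]
  exact Finset.sum_congr rfl fun i _ => (YoungDiagram.rowLen_eq_card lam).symm

/-- The strictly decreasing sequence `λ_i + N - i` attached to a diagram (rows from `0`). -/
def shiftedRow (N : ℕ) (lam : YoungDiagram) (i : Fin N) : ℕ := lam.rowLen i + (N - 1 - (i : ℕ))

theorem shiftedRow_strictAnti (N : ℕ) (lam : YoungDiagram) : StrictAnti (shiftedRow N lam) := by
  intro i j hij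
  have h1 := lam.rowLen_anti i j (by exact_mod_cast hij.le)
  have := i.2
  have := j.2
  have : (i : ℕ) < j := hij
  unfold shiftedRow
  omega

theorem shiftedRow_le_iff {N : ℕ} {mu lam : YoungDiagram} (hmu : len mu ≤ N) :
    (∀ i, shiftedRow N mu i ≤ shiftedRow N lam i) ↔ mu ≤ lam := by
  rw [le_iff_rowLen_le]
  constructor
  · intro h i
    by_cases hi : i < N
    · have := h ⟨i, hi⟩
      simp only [shiftedRow] at this
      omega
    · rw [rowLen_eq_zero (by omega)]
      omega
  · intro h i
    have := h i
    unfold shiftedRow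
    omega

theorem shiftedRow_injective {N : ℕ} {mu lam : YoungDiagram} (hmu : len mu ≤ N)
    (hlam : len lam ≤ N) (h : shiftedRow N mu = shiftedRow N lam) : mu = lam :=
  le_antisymm ((shiftedRow_le_iff hmu).mp fun i => (congrFun h i).le)
    ((shiftedRow_le_iff hlam).mp fun i => (congrFun h i).ge)

/-- Strict decrease forces `k_i ≥ k_j + (j - i)` for `i ≤ j`, hence `k_i ≥ N - 1 - i`. The natural
subtraction `k_i - (N - 1 - i)` is therefore not truncated, and its values are weakly decreasing in
`i`. -/
theorem exists_shiftedRow_eq {N : ℕ} (k : Fin N → ℕ) (hk : StrictAnti k) :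
    ∃ lam : YoungDiagram, len lam ≤ N ∧ shiftedRow N lam = k := by
  have hle : ∀ d : ℕ, ∀ i j : Fin N, (j : ℕ) = i + d → k j + d ≤ k i := by
    intro d
    induction d with
    | zero => intro i j h; have : i = j := Fin.ext (by omega); simp [this]
    | succ d ih =>
      intro i j h
      have hj := j.2
      have h1 := ih i ⟨i + d, by omega⟩ rfl
      have h2 : k j < k ⟨i + d, by omega⟩ := hk (by rw [Fin.lt_def]; simp; omega)
      omega
  let a : ℕ → ℕ := fun i => if h : i < N then k ⟨i, h⟩ - (N - 1 - i) else 0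
  have hge : ∀ i : Fin N, N - 1 - (i : ℕ) ≤ k i := by
    intro i
    have hi := i.2
    have := hle (N - 1 - i) i ⟨N - 1, by omega⟩ (by simp; omega)
    omega
  have ha : Antitone a := by
    intro i j hij
    by_cases hj : j < N
    · have hi : i < N := by omega
      simp only [a, hi, hj, dif_pos]
      have := hle (j - i) ⟨i, hi⟩ ⟨j, hj⟩ (by simp; omega)
      omega
    · simp [a, hj]
  obtain ⟨lam, h1, h2⟩ := exists_rowLen_eq a ha N (by simp [a])
  refine ⟨lam, h1, funext fun i => ?_⟩
  have := hge i
  simp only [shiftedRow, h2, a, i.2, dif_pos, Fin.eta]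
  omega

theorem exists_shiftedRow_comp_eq {N : ℕ} (k : Fin N → ℕ) (hk : Function.Injective k) :
    ∃ (lam : YoungDiagram) (τ : Equiv.Perm (Fin N)), len lam ≤ N ∧ shiftedRow N lam ∘ τ = k := by
  have hmono : StrictMono (k ∘ Tuple.sort k) :=
    (Tuple.monotone_sort k).strictMono_of_injective (hk.comp (Tuple.sort k).injective)
  have hanti : StrictAnti (k ∘ (Fin.revPerm.trans (Tuple.sort k))) := by
    intro i j hij
    exact hmono (by simpa using hij)
  obtain ⟨lam, h1, h2⟩ := exists_shiftedRow_eq _ hanti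
  refine ⟨lam, (Fin.revPerm.trans (Tuple.sort k)).symm, h1, ?_⟩
  rw [h2]
  ext i
  simp

/-- The decreasing rearrangement of a tuple is unique, and since its entries are distinct so is the
permutation producing it. -/
theorem shiftedRow_comp_injective {N : ℕ} {mu lam : YoungDiagram} (hmu : len mu ≤ N)
    (hlam : len lam ≤ N) {σ τ : Equiv.Perm (Fin N)}
    (h : shiftedRow N mu ∘ σ = shiftedRow N lam ∘ τ) : mu = lam ∧ σ = τ := by
  have key : shiftedRow N mu = shiftedRow N lam := by
    have h' : shiftedRow N lam ∘ (σ.symm.trans τ) = shiftedRow N mu := by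
      ext i
      have := congrFun h (σ.symm i)
      simpa using this.symm
    have := Tuple.unique_antitone (f := shiftedRow N lam) (σ := σ.symm.trans τ)
      (τ := Equiv.refl _) (by rw [h']; exact (shiftedRow_strictAnti N mu).antitone)
      (by simpa using (shiftedRow_strictAnti N lam).antitone)
    rw [← h', this]
    rfl
  refine ⟨shiftedRow_injective hmu hlam key, Equiv.ext fun i => ?_⟩
  rw [key] at h
  exact (shiftedRow_strictAnti N lam).injective (congrFun h i)

/-- If a permuted shifted sequence of `μ` is dominated by that of `λ`, then `μ ⊆ λ`. -/
theorem le_of_shiftedRow_perm_le {N : ℕ} {mu lam : YoungDiagram} (hmu : len mu ≤ N)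
    (τ : Equiv.Perm (Fin N)) (h : ∀ i, shiftedRow N mu (τ i) ≤ shiftedRow N lam i) : mu ≤ lam := by
  rw [← shiftedRow_le_iff hmu]
  intro i
  -- Pigeonhole: `τ` cannot map the `N - i` indices `≥ i` into the `N - i - 1` indices `> i`. With
  -- such a `j`, monotonicity gives `μ_i ≤ μ_{τ j} ≤ λ_j ≤ λ_i` for the shifted rows.
  obtain ⟨j, hij, hj⟩ : ∃ j, i ≤ j ∧ τ j ≤ i := by
    by_contra! hcon
    have h1 : (Finset.Ici i).map τ.toEmbedding ⊆ Finset.Ioi i := by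
      intro x hx
      simp only [Finset.mem_map, Finset.mem_Ici] at hx
      obtain ⟨j, hj, rfl⟩ := hx
      exact Finset.mem_Ioi.mpr (hcon j hj)
    have h2 := Finset.card_le_card h1
    rw [Finset.card_map, Fin.card_Ici, Fin.card_Ioi] at h2
    have := i.2
    omega
  exact ((shiftedRow_strictAnti N mu).antitone hj).trans
    ((h j).trans ((shiftedRow_strictAnti N lam).antitone hij))

/-- A sum over injective tuples, organized by their decreasing rearrangements. -/
theorem sum_pi_eq_sum_shiftedRow {M : Type*} [AddCommMonoid M] {N B : ℕ} (f : (Fin N → ℕ) → M)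
    (S : Finset YoungDiagram) (hlen : ∀ lam ∈ S, len lam ≤ N)
    (hbox : ∀ lam ∈ S, ∀ i, shiftedRow N lam i < B)
    (hinj : ∀ k, ¬ Function.Injective k → f k = 0)
    (hS : ∀ lam τ, len lam ≤ N → (∀ i, shiftedRow N lam i < B) → lam ∉ S →
      f (shiftedRow N lam ∘ (τ : Equiv.Perm (Fin N))) = 0) :
    ∑ k ∈ Fintype.piFinset (fun _ : Fin N => Finset.range B), f k =
      ∑ lam ∈ S, ∑ τ : Equiv.Perm (Fin N), f (shiftedRow N lam ∘ τ) := by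
  rw [← Finset.sum_product']
  symm
  apply Finset.sum_of_injOn (fun p : YoungDiagram × Equiv.Perm (Fin N) => shiftedRow N p.1 ∘ p.2)
  · rintro ⟨mu, σ⟩ hmu ⟨lam, τ⟩ hlam h
    simp only [Finset.coe_product, Set.mem_prod, SetLike.mem_coe] at hmu hlam
    obtain ⟨rfl, rfl⟩ := shiftedRow_comp_injective (hlen _ hmu.1) (hlen _ hlam.1) h
    rfl
  · rintro ⟨mu, σ⟩ hmu
    simp only [Finset.coe_product, Set.mem_prod, SetLike.mem_coe] at hmu
    simp only [SetLike.mem_coe, Fintype.mem_piFinset, Finset.mem_range]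
    exact fun i => hbox _ hmu.1 _
  · intro k hk hnot
    by_cases hki : Function.Injective k
    · obtain ⟨lam, τ, h1, rfl⟩ := exists_shiftedRow_comp_eq k hki
      simp only [Fintype.mem_piFinset, Finset.mem_range] at hk
      refine hS lam τ h1 (fun i => by simpa using hk (τ.symm i)) fun hmem => hnot ?_
      exact ⟨(lam, τ), by simpa using hmem, rfl⟩
    · exact hinj k hki
  · intros; rfl

/-! ### Expansion of alternants -/

theorem vand_ne_zero (N : ℕ) : vand N ≠ 0 := by
  refine Finset.prod_ne_zero_iff.mpr fun p hp h => ?_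
  have h1 := MvPolynomial.X_injective (sub_eq_zero.mp h)
  simp [h1] at hp

theorem alternantQuot_eq_iff {N : ℕ} {f : Fin N → Polynomial ℂ} {P : MvPolynomial (Fin N) ℂ} :
    alternantQuot f = P ↔ alternant f = vand N * P := by
  rw [← vand_mul_alternantQuot]
  exact ⟨fun h => by rw [h], fun h => mul_left_cancel₀ (vand_ne_zero N) h⟩

theorem alternant_comp_perm {N : ℕ} (f : Fin N → Polynomial ℂ) (τ : Equiv.Perm (Fin N)) :
    alternant (f ∘ τ) = (Equiv.Perm.sign τ : ℤ) • alternant f := by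
  unfold alternant
  rw [zsmul_eq_mul, ← Matrix.det_permute]
  rfl

theorem alternant_eq_zero {N : ℕ} {f : Fin N → Polynomial ℂ} (hf : ¬ Function.Injective f) :
    alternant f = 0 := by
  simp only [Function.Injective, not_forall] at hf
  obtain ⟨i, j, h, hij⟩ := hf
  exact Matrix.det_zero_of_row_eq hij (funext fun k => by simp [h])

/-- Alternants are multilinear in the polynomials. -/
theorem alternant_sum {N : ℕ} (s : Finset ℕ) (A : Fin N → ℕ → ℂ) (P : ℕ → Polynomial ℂ) :
    alternant (fun i => ∑ k ∈ s, A i k • P k) =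
      ∑ k ∈ Fintype.piFinset (fun _ : Fin N => s), (∏ i, A i (k i)) • alternant (P ∘ k) := by
  have h1 : alternant (fun i => ∑ k ∈ s, A i k • P k) =
      (Matrix.detRowAlternating (R := MvPolynomial (Fin N) ℂ)).toMultilinearMap
        (fun i => ∑ k ∈ s, (MvPolynomial.C (A i k) : MvPolynomial (Fin N) ℂ) •
          (fun j : Fin N => Polynomial.aeval (MvPolynomial.X j : MvPolynomial (Fin N) ℂ) (P k))) := by
    show Matrix.det _ = Matrix.det _
    congr 1
    ext1 i j
    simp [Finset.sum_apply, map_sum, MvPolynomial.smul_eq_C_mul]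
  rw [h1, MultilinearMap.map_sum_finset]
  refine Finset.sum_congr rfl fun k _ => ?_
  rw [MultilinearMap.map_smul_univ, ← map_prod, smul_eq_mul, ← MvPolynomial.smul_eq_C_mul]
  rfl

/-- The minor of a lower triangular array with rows and columns given by shifted sequences. -/
def shiftedMinor (A : ℕ → ℕ → ℂ) (N : ℕ) (lam mu : YoungDiagram) : ℂ :=
  Matrix.det (Matrix.of fun i j : Fin N => A (shiftedRow N lam i) (shiftedRow N mu j))

/-- Cauchy--Binet expansion of the alternant of a triangular change of basis. -/
theorem alternant_triangular {A : ℕ → ℕ → ℂ} (hA : ∀ n m, n < m → A n m = 0)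
    {P Q : ℕ → Polynomial ℂ} (hQ : ∀ n, Q n = ∑ m ∈ Finset.range (n + 1), A n m • P m)
    {N : ℕ} {lam : YoungDiagram} (hN : len lam ≤ N) :
    alternant (fun i => Q (shiftedRow N lam i)) =
      ∑ mu ∈ subdiagrams lam,
        shiftedMinor A N lam mu • alternant (fun i => P (shiftedRow N mu i)) := by
  -- A common bound for all shifted entries of all `μ ⊆ λ`, so that the multilinear expansion runs
  -- over one finite box.
  set B := lam.rowLen 0 + N with hB
  have hlt : ∀ (mu : YoungDiagram), mu ≤ lam → ∀ i, shiftedRow N mu i < B := by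
    intro mu hmu i
    have h1 := le_iff_rowLen_le.mp hmu 0
    have h2 := mu.rowLen_anti 0 i (Nat.zero_le _)
    have := i.2
    unfold shiftedRow
    omega
  have hQ' : (fun i => Q (shiftedRow N lam i)) =
      fun i => ∑ k ∈ Finset.range B, A (shiftedRow N lam i) k • P k := by
    ext1 i
    rw [hQ]
    apply Finset.sum_subset
    · intro k hk
      have := hlt lam le_rfl i
      simp only [Finset.mem_range] at hk ⊢
      omega
    · intro k _ hk
      rw [hA _ _ (by simpa [Nat.lt_succ_iff] using hk), zero_smul]
  rw [hQ', alternant_sum, sum_pi_eq_sum_shiftedRow _ (subdiagrams lam)]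
  · refine Finset.sum_congr rfl fun mu _ => ?_
    -- The Leibniz formula permutes the rows (indexed by `λ`), whereas the tuples `shiftedRow N mu ∘
    -- τ` permute the columns; inverting the permutation matches the two sums.
    rw [shiftedMinor, Matrix.det_apply, Finset.sum_smul, ← Equiv.sum_comp (Equiv.inv _)]
    refine Finset.sum_congr rfl fun τ _ => ?_
    have := alternant_comp_perm (fun i => P (shiftedRow N mu i)) τ⁻¹
    rw [Equiv.inv_apply, ← Function.comp_assoc]
    erw [this]
    rw [smul_comm, ← smul_assoc, Equiv.Perm.sign_inv]
    congr 1
    rw [Units.smul_def, ← Equiv.prod_comp τ]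
    simp
  · intro mu hmu
    exact (len_mono (mem_subdiagrams.mp hmu)).trans hN
  · intro mu hmu
    exact hlt _ (mem_subdiagrams.mp hmu)
  · intro k hk
    rw [alternant_eq_zero, smul_zero]
    exact fun h => hk h.of_comp
  · intro mu τ hmu _ hnot
    -- If `μ ⊄ λ`, every rearrangement of `μ` exceeds `λ` somewhere, and triangularity of `A` kills
    -- the term.
    have : ∃ i, shiftedRow N lam i < shiftedRow N mu (τ i) := by
      by_contra! h
      exact hnot (mem_subdiagrams.mpr (le_of_shiftedRow_perm_le hmu τ h))
    obtain ⟨i, hi⟩ := this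
    rw [Finset.prod_eq_zero (Finset.mem_univ i) (hA _ _ hi), zero_smul]

theorem alternantQuot_triangular {A : ℕ → ℕ → ℂ} (hA : ∀ n m, n < m → A n m = 0)
    {P Q : ℕ → Polynomial ℂ} (hQ : ∀ n, Q n = ∑ m ∈ Finset.range (n + 1), A n m • P m)
    {N : ℕ} {lam : YoungDiagram} (hN : len lam ≤ N) :
    alternantQuot (fun i => Q (shiftedRow N lam i)) =
      ∑ mu ∈ subdiagrams lam,
        shiftedMinor A N lam mu • alternantQuot (fun i => P (shiftedRow N mu i)) := by
  rw [alternantQuot_eq_iff, alternant_triangular hA hQ hN, Finset.mul_sum]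
  simp only [mul_smul_comm, vand_mul_alternantQuot]

/-- A minor of a unitriangular array depends only on the first `ℓ(λ)` rows and columns. -/
theorem shiftedMinor_eq_det {A : ℕ → ℕ → ℂ} (hA : ∀ n m, n < m → A n m = 0)
    (hA1 : ∀ n, A n n = 1) {N : ℕ} {lam mu : YoungDiagram} (hN : len lam ≤ N) (hmu : mu ≤ lam) :
    shiftedMinor A N lam mu = Matrix.det (Matrix.of fun i j : Fin (len lam) =>
      A (lam.rowLen i + (N - 1 - (i : ℕ))) (mu.rowLen j + (N - 1 - (j : ℕ)))) := by
  obtain ⟨n, rfl⟩ := Nat.exists_eq_add_of_le hN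
  unfold shiftedMinor
  rw [← Matrix.det_reindex_self finSumFinEquiv.symm, ← Matrix.fromBlocks_toBlocks
    (Matrix.reindex _ _ _), Matrix.toBlocks₂₁, Matrix.toBlocks₂₂]
  -- Row `len lam + i` is empty, so its shifted entry is `n - 1 - i`, smaller than the shifted entry
  -- of each of the first `len lam` columns. The matrix is block upper triangular with a
  -- unitriangular lower right block.
  have h21 : (Matrix.of fun i j => Matrix.reindex finSumFinEquiv.symm finSumFinEquiv.symm
      (Matrix.of fun i j : Fin (len lam + n) => A (shiftedRow (len lam + n) lam i)
        (shiftedRow (len lam + n) mu j)) (Sum.inr i) (Sum.inl j)) = 0 := by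
    ext i j
    have := i.2
    have := j.2
    apply hA
    have h := rowLen_eq_zero (lam := lam) (i := len lam + i) (by omega)
    simp [shiftedRow, h]
    omega
  rw [h21, Matrix.det_fromBlocks_zero₂₁]
  have h22 : ∀ i j : Fin n, Matrix.reindex finSumFinEquiv.symm finSumFinEquiv.symm
      (Matrix.of fun i j : Fin (len lam + n) => A (shiftedRow (len lam + n) lam i)
        (shiftedRow (len lam + n) mu j)) (Sum.inr i) (Sum.inr j) =
      A (n - 1 - i) (n - 1 - j) := by
    intro i j
    have := i.2
    have := j.2
    have h1 := rowLen_eq_zero (lam := lam) (i := len lam + i) (by omega)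
    have h2 := rowLen_eq_zero (lam := mu) (i := len lam + j) (by have := len_mono hmu; omega)
    simp [shiftedRow, h1, h2]
    congr 1 <;> omega
  have hdet : Matrix.det (Matrix.of fun i j : Fin n => A (n - 1 - i) (n - 1 - j)) = 1 := by
    rw [Matrix.det_of_isUpperTriangular, Finset.prod_eq_one]
    · intro i _
      exact hA1 _
    · intro i j hij
      have := i.2
      have h : (j : ℕ) < i := hij
      exact hA _ _ (by omega)
  simp only [h22]
  rw [hdet, mul_one]
  rfl

theorem shiftedMinor_self {A : ℕ → ℕ → ℂ} (hA : ∀ n m, n < m → A n m = 0)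
    (hA1 : ∀ n, A n n = 1) (N : ℕ) (lam : YoungDiagram) :
    shiftedMinor A N lam lam = 1 := by
  unfold shiftedMinor
  rw [Matrix.det_of_isUpperTriangular, Finset.prod_eq_one]
  · intro i _
    exact hA1 _
  · intro i j hij
    exact hA _ _ (shiftedRow_strictAnti N lam hij)

/-! ### Restriction of symmetric functions to finitely many variables -/

theorem coeff_embDomain_perm (F : SymFun) (π : Equiv.Perm ℕ) (m : ℕ →₀ ℕ) :
    MvPowerSeries.coeff (m.embDomain π.toEmbedding) F.1 = MvPowerSeries.coeff m F.1 := by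
  conv_lhs => rw [← F.2.1 π]
  exact MvPowerSeries.coeff_embDomain_rename π.toEmbedding F.1 m

theorem degree_embDomain {σ τ : Type*} (e : σ ↪ τ) (m : σ →₀ ℕ) :
    (m.embDomain e).degree = m.degree := by
  show ∑ i ∈ (m.embDomain e).support, m.embDomain e i = ∑ i ∈ m.support, m i
  rw [Finsupp.support_embDomain, Finset.sum_map]
  exact Finset.sum_congr rfl fun i _ => Finsupp.embDomain_apply_self _ _ _

/-- Bounded total degree bounds every exponent by `D`, and finitely many variables leave only
finitely many such exponent vectors, so truncating at `(D, …, D)` loses nothing. -/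
theorem exists_coe_eq_killCompl (N : ℕ) (F : SymFun) : ∃ P : MvPolynomial (Fin N) ℂ,
    (P : MvPowerSeries (Fin N) ℂ) = MvPowerSeries.killCompl Fin.valEmbedding F.1 := by
  obtain ⟨-, D, hD⟩ := F.2
  refine ⟨MvPowerSeries.trunc' ℂ (Finsupp.equivFunOnFinite.symm fun _ => D)
    (MvPowerSeries.killCompl Fin.valEmbedding F.1), ?_⟩
  ext m
  rw [MvPolynomial.coeff_coe, MvPowerSeries.coeff_trunc']
  split_ifs with h
  · rfl
  · rw [MvPowerSeries.coeff_killCompl, hD]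
    rw [degree_embDomain]
    simp only [Finsupp.le_def, not_forall, not_le] at h
    obtain ⟨i, hi⟩ := h
    exact lt_of_lt_of_le hi (Finsupp.le_degree i m)

/-- Restriction of a symmetric function to the first `N` variables. -/
def res (N : ℕ) : SymFun →ₐ[ℂ] MvPolynomial (Fin N) ℂ :=
  AlgHom.ofLinearMap
    { toFun := fun F => (exists_coe_eq_killCompl N F).choose
      map_add' := fun F G => MvPolynomial.coe_injective _ _ (by
        rw [MvPolynomial.coe_add]
        simp only [(exists_coe_eq_killCompl N _).choose_spec]
        exact map_add _ _ _)
      map_smul' := fun a F => MvPolynomial.coe_injective _ _ (by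
        rw [RingHom.id_apply, MvPolynomial.coe_smul]
        simp only [(exists_coe_eq_killCompl N _).choose_spec]
        exact map_smul _ _ _) }
    (MvPolynomial.coe_injective _ _ (by
      rw [MvPolynomial.coe_one]
      exact (exists_coe_eq_killCompl N _).choose_spec.trans (map_one _)))
    (fun F G => MvPolynomial.coe_injective _ _ (by
      rw [MvPolynomial.coe_mul]
      show ((exists_coe_eq_killCompl N _).choose : MvPowerSeries (Fin N) ℂ) =
        ((exists_coe_eq_killCompl N _).choose : MvPowerSeries (Fin N) ℂ) *
        ((exists_coe_eq_killCompl N _).choose : MvPowerSeries (Fin N) ℂ)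
      simp only [(exists_coe_eq_killCompl N _).choose_spec]
      exact map_mul _ _ _))

theorem coeff_res (N : ℕ) (F : SymFun) (m : Fin N →₀ ℕ) :
    MvPolynomial.coeff m (res N F) = MvPowerSeries.coeff (m.embDomain Fin.valEmbedding) F.1 := by
  rw [← MvPowerSeries.coeff_killCompl, ← (exists_coe_eq_killCompl N F).choose_spec,
    MvPolynomial.coeff_coe]
  rfl

theorem rename_res {N : ℕ} (σ : Equiv.Perm (Fin N)) (F : SymFun) :
    MvPolynomial.rename σ (res N F) = res N F := by
  ext m
  have hm : m = (m.embDomain σ.symm.toEmbedding).embDomain σ.toEmbedding := by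
    rw [Finsupp.embDomain_eq_mapDomain, Finsupp.embDomain_eq_mapDomain, ← Finsupp.mapDomain_comp]
    simp
  rw [hm, ← Equiv.coe_toEmbedding, MvPolynomial.coeff_rename_embDomain, ← hm, coeff_res, coeff_res]
  conv_rhs => rw [hm]
  rw [← coeff_embDomain_perm F (σ.viaEmbedding Fin.valEmbedding)]
  refine congrArg (fun k => MvPowerSeries.coeff k F.1) ?_
  simp only [Finsupp.embDomain_eq_mapDomain, ← Finsupp.mapDomain_comp]
  refine Finsupp.mapDomain_congr fun x _ => ?_
  exact Equiv.Perm.viaEmbedding_apply σ Fin.valEmbedding (σ.symm x)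

/-- A monomial supported in the first `N` variables comes from `Fin N`. -/
theorem exists_embDomain_eq {N : ℕ} {m : ℕ →₀ ℕ} (h : ∀ i ∈ m.support, i < N) :
    ∃ m' : Fin N →₀ ℕ, m'.embDomain Fin.valEmbedding = m :=
  ⟨m.comapDomain Fin.valEmbedding Fin.valEmbedding.injective.injOn,
    Finsupp.embDomain_comapDomain fun i hi => ⟨⟨i, h i hi⟩, rfl⟩⟩

theorem coeff_rename_val {N : ℕ} (P : MvPolynomial (Fin N) ℂ) (m : Fin N →₀ ℕ) :
    MvPolynomial.coeff (m.embDomain Fin.valEmbedding) (MvPolynomial.rename Fin.val P) =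
      MvPolynomial.coeff m P :=
  MvPolynomial.coeff_rename_embDomain Fin.valEmbedding P m

theorem coeff_rename_res {N : ℕ} {m : ℕ →₀ ℕ} (h : ∀ i ∈ m.support, i < N) (F : SymFun) :
    MvPolynomial.coeff m (MvPolynomial.rename Fin.val (res N F)) = MvPowerSeries.coeff m F.1 := by
  obtain ⟨m', rfl⟩ := exists_embDomain_eq h
  rw [← coeff_res, coeff_rename_val]

theorem eventually_support_lt (m : ℕ →₀ ℕ) :
    ∀ᶠ N in Filter.atTop, ∀ i ∈ m.support, i < N := by
  filter_upwards [Filter.eventually_gt_atTop (m.support.sup id)] with N hN i hi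
  exact lt_of_le_of_lt (Finset.le_sup (f := id) hi) hN

theorem totalDegree_res_le {D : ℕ} {F : SymFun}
    (hF : ∀ m : ℕ →₀ ℕ, D < m.degree → MvPowerSeries.coeff m F.1 = 0) (N : ℕ) :
    (res N F).totalDegree ≤ D := by
  refine Finset.sup_le fun m hm => ?_
  by_contra! h
  replace h : D < m.degree := h
  rw [MvPolynomial.mem_support_iff, coeff_res] at hm
  exact hm (hF _ (by rw [degree_embDomain]; exact h))

/-- A permutation of the variables moves any monomial of degree at most `N` into the first `N`
variables, so such monomials are seen by the restriction to `N` variables. -/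
theorem eq_of_res_eq {N : ℕ} {F G : SymFun}
    (hF : ∀ m : ℕ →₀ ℕ, N < m.degree → MvPowerSeries.coeff m F.1 = 0)
    (hG : ∀ m : ℕ →₀ ℕ, N < m.degree → MvPowerSeries.coeff m G.1 = 0)
    (h : res N F = res N G) : F = G := by
  apply Subtype.ext
  ext m
  by_cases hm : N < m.degree
  · rw [hF m hm, hG m hm]
  · have hcard : m.support.card ≤ N := by
      refine le_trans ?_ (not_lt.mp hm)
      rw [Finset.card_eq_sum_ones]
      exact Finset.sum_le_sum fun i hi => Nat.one_le_iff_ne_zero.mpr (Finsupp.mem_support_iff.mp hi)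
    -- Inside a `Fin M` large enough to contain both, the support of `m` is matched with an
    -- equinumerous subset of the first `N` indices; the bijection extends to a permutation of `Fin
    -- M`, then of `ℕ`.
    obtain ⟨π, hπ⟩ : ∃ π : Equiv.Perm ℕ, ∀ i ∈ m.support, π i < N := by
      obtain ⟨M, hM1, hM2⟩ := ((eventually_support_lt m).and (Filter.eventually_ge_atTop N)).exists
      obtain ⟨s, hs1, hs2⟩ := Finset.exists_subset_card_eq (s := Finset.range N)
        (n := m.support.card) (by simpa using hcard)
      let e : {x : Fin M // (x : ℕ) ∈ m.support} ≃ {x : Fin M // (x : ℕ) ∈ s} := by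
        refine Fintype.equivOfCardEq ?_
        have key : ∀ t : Finset ℕ, (∀ i ∈ t, i < M) →
            Fintype.card {x : Fin M // (x : ℕ) ∈ t} = t.card := by
          intro t ht
          rw [← Fintype.card_coe]
          exact Fintype.card_congr
            { toFun := fun x => ⟨x.1, x.2⟩
              invFun := fun x => ⟨⟨x.1, ht _ x.2⟩, x.2⟩
              left_inv := fun _ => rfl
              right_inv := fun _ => rfl }
        rw [key _ hM1, key _ fun i hi => (Finset.mem_range.mp (hs1 hi)).trans_le hM2, hs2]
      refine ⟨e.extendSubtype.viaEmbedding Fin.valEmbedding, fun i hi => ?_⟩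
      have h1 := Equiv.Perm.viaEmbedding_apply e.extendSubtype Fin.valEmbedding ⟨i, hM1 i hi⟩
      have h2 := e.extendSubtype_mem ⟨i, hM1 i hi⟩ hi
      simp only [Fin.valEmbedding_apply] at h1
      rw [h1]
      exact Finset.mem_range.mp (hs1 h2)
    have hsupp : ∀ i ∈ (m.embDomain π.toEmbedding).support, i < N := by
      intro i hi
      rw [Finsupp.support_embDomain, Finset.mem_map] at hi
      obtain ⟨j, hj, rfl⟩ := hi
      exact hπ j hj
    rw [← coeff_embDomain_perm F π, ← coeff_embDomain_perm G π, ← coeff_rename_res hsupp,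
      ← coeff_rename_res hsupp, h]

/-- A stable sequence of symmetric polynomials of bounded degree defines a symmetric function. -/
theorem exists_res_eq (P : (N : ℕ) → MvPolynomial (Fin N) ℂ) (N₀ D : ℕ)
    (hsym : ∀ N, N₀ ≤ N → ∀ σ : Equiv.Perm (Fin N), MvPolynomial.rename σ (P N) = P N)
    (hstab : ∀ N, N₀ ≤ N →
      MvPolynomial.killCompl (Fin.castSucc_injective N) (P (N + 1)) = P N)
    (hdeg : ∀ N, N₀ ≤ N → (P N).totalDegree ≤ D) :
    ∃ F : SymFun, (∀ N, N₀ ≤ N → res N F = P N) ∧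
      ∀ m : ℕ →₀ ℕ, D < m.degree → MvPowerSeries.coeff m F.1 = 0 := by
  have hstab' : ∀ m : ℕ →₀ ℕ, ∀ N, N₀ ≤ N → (∀ i ∈ m.support, i < N) → ∀ d,
      MvPolynomial.coeff m (MvPolynomial.rename Fin.val (P (N + d))) =
        MvPolynomial.coeff m (MvPolynomial.rename Fin.val (P N)) := by
    intro m N hN hm d
    induction d with
    | zero => rfl
    | succ d ih =>
      rw [← ih]
      obtain ⟨m', rfl⟩ := exists_embDomain_eq (N := N + d) (fun i hi => by have := hm i hi; omega)
      have h1 : m'.embDomain Fin.valEmbedding =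
          (m'.embDomain Fin.castSuccEmb).embDomain Fin.valEmbedding := by
        simp only [Finsupp.embDomain_eq_mapDomain, ← Finsupp.mapDomain_comp]
        rfl
      have h3 := coeff_rename_val (P (N + (d + 1))) (m'.embDomain Fin.castSuccEmb)
      rw [← h1] at h3
      rw [coeff_rename_val, h3, ← hstab (N + d) (by omega), MvPolynomial.coeff_killCompl,
        Finsupp.embDomain_eq_mapDomain]
      rfl
  -- The coefficient of `m` is read off from any `P N` with `N ≥ N₀` and `N` beyond the support of
  -- `m`; by stability the choice is immaterial.
  let bd : (ℕ →₀ ℕ) → ℕ := fun m => N₀ + (m.support.sup id + 1)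
  have hbd : ∀ m : ℕ →₀ ℕ, ∀ i ∈ m.support, i < bd m := by
    intro m i hi
    have : i ≤ m.support.sup id := Finset.le_sup (f := id) hi
    simp only [bd]
    omega
  let G : MvPowerSeries ℕ ℂ := fun m =>
    MvPolynomial.coeff m (MvPolynomial.rename Fin.val (P (bd m)))
  have hG : ∀ m N, N₀ ≤ N → (∀ i ∈ m.support, i < N) → MvPowerSeries.coeff m G =
      MvPolynomial.coeff m (MvPolynomial.rename Fin.val (P N)) := by
    intro m N hN hm
    show MvPolynomial.coeff m (MvPolynomial.rename Fin.val (P (bd m))) = _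
    rw [← hstab' m N hN hm (bd m), ← hstab' m (bd m) (by simp [bd]) (hbd m) N, add_comm]
  have hGdeg : ∀ m : ℕ →₀ ℕ, D < m.degree → MvPowerSeries.coeff m G = 0 := by
    intro m hm
    obtain ⟨m', hm'⟩ := exists_embDomain_eq (hbd m)
    have h1 := coeff_rename_val (P (bd m)) m'
    rw [hm'] at h1
    rw [hG m (bd m) (by simp [bd]) (hbd m), h1]
    apply MvPolynomial.coeff_eq_zero_of_totalDegree_lt
    refine lt_of_le_of_lt (hdeg _ (by simp [bd])) ?_
    rw [← hm', degree_embDomain] at hm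
    exact hm
  refine ⟨⟨G, fun π => ?_, D, hGdeg⟩, fun N hN => ?_, hGdeg⟩
  · ext m
    obtain ⟨m', rfl⟩ : ∃ m' : ℕ →₀ ℕ, m'.embDomain π.toEmbedding = m := by
      refine ⟨m.embDomain π.symm.toEmbedding, ?_⟩
      simp only [Finsupp.embDomain_eq_mapDomain, ← Finsupp.mapDomain_comp]
      simp
    have h1 : MvPowerSeries.coeff (m'.embDomain π.toEmbedding) (MvPowerSeries.renameEquiv ℂ π G) =
      MvPowerSeries.coeff m' G := MvPowerSeries.coeff_embDomain_rename π.toEmbedding G m'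
    rw [h1]
    obtain ⟨N, ⟨hN, hm⟩, hm'⟩ := (((Filter.eventually_ge_atTop N₀).and (eventually_support_lt
      (m'.embDomain π.toEmbedding))).and (eventually_support_lt m')).exists
    rw [hG _ N hN hm, hG _ N hN hm']
    -- `π` need not preserve the first `N` indices. It is replaced by a permutation of `Fin N` that
    -- agrees with it on the support of `m'`, to which the symmetry of `P N` applies.
    let e : {x : Fin N // (x : ℕ) ∈ m'.support} ≃
        {x : Fin N // (x : ℕ) ∈ (m'.embDomain π.toEmbedding).support} :=
      { toFun := fun x => ⟨⟨π x.1, hm _ (by simpa using x.2)⟩, by simpa using x.2⟩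
        invFun := fun x => ⟨⟨π.symm x.1, hm' _ (by
            have := x.2
            simp only [Finsupp.support_embDomain, Finset.mem_map] at this
            obtain ⟨a, ha, hx⟩ := this
            rw [← hx]
            simpa using ha)⟩, by
            have := x.2
            simp only [Finsupp.support_embDomain, Finset.mem_map] at this
            obtain ⟨a, ha, hx⟩ := this
            simp only [← hx]
            simpa using ha⟩
        left_inv := fun x => Subtype.ext (Fin.ext (by simp))
        right_inv := fun x => Subtype.ext (Fin.ext (by simp)) }
    obtain ⟨k, rfl⟩ := exists_embDomain_eq hm'
    have h2 : (k.embDomain Fin.valEmbedding).embDomain π.toEmbedding =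
        (k.embDomain e.extendSubtype.toEmbedding).embDomain Fin.valEmbedding := by
      simp only [Finsupp.embDomain_eq_mapDomain, ← Finsupp.mapDomain_comp]
      refine Finsupp.mapDomain_congr fun x hx => ?_
      have hx' : (x : ℕ) ∈ (k.embDomain Fin.valEmbedding).support := by
        rw [Finsupp.support_embDomain]
        exact Finset.mem_map_of_mem _ hx
      have := e.extendSubtype_apply_of_mem x hx'
      show π (x : ℕ) = ((e.extendSubtype x : Fin N) : ℕ)
      rw [this]
      rfl
    rw [h2, coeff_rename_val, coeff_rename_val]
    conv_rhs => rw [← hsym N hN e.extendSubtype]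
    exact (MvPolynomial.coeff_rename_embDomain e.extendSubtype.toEmbedding (P N) k).symm
  · ext m
    rw [coeff_res]
    have hm : ∀ i ∈ (m.embDomain Fin.valEmbedding).support, i < N := by
      intro i hi
      rw [Finsupp.support_embDomain, Finset.mem_map] at hi
      obtain ⟨j, -, rfl⟩ := hi
      exact j.2
    rw [hG _ N hN hm, coeff_rename_val]

/-! ### Schur functions -/

/-- The Schur polynomial `det[x_j^{λ_i + N - i}] / V(x)`. -/
def schurPoly (N : ℕ) (lam : YoungDiagram) : MvPolynomial (Fin N) ℂ :=
  alternantQuot fun i : Fin N => Polynomial.X ^ shiftedRow N lam i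

theorem alternant_X_pow {N : ℕ} (k : Fin N → ℕ) :
    alternant (fun i => Polynomial.X ^ k i) =
      Matrix.det (Matrix.of fun i j : Fin N => (MvPolynomial.X j : MvPolynomial (Fin N) ℂ) ^ k i) := by
  simp [alternant]

/-- The standard Vandermonde matrix has increasing exponents and factors `v_j - v_i` for `i < j`.
Reversing rows and columns simultaneously preserves the determinant and corrects both orientations,
so no sign appears. -/
theorem vand_eq_alternant (N : ℕ) :
    vand N = alternant fun i : Fin N => Polynomial.X ^ shiftedRow N ⊥ i := by
  rw [alternant_X_pow, ← Matrix.det_transpose, ← Matrix.det_reindex_self Fin.revPerm]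
  have h1 : Matrix.reindex Fin.revPerm Fin.revPerm (Matrix.transpose (Matrix.of fun i j : Fin N =>
      (MvPolynomial.X j : MvPolynomial (Fin N) ℂ) ^ shiftedRow N ⊥ i)) =
      Matrix.vandermonde fun i => MvPolynomial.X (Fin.rev i) := by
    ext1 i j
    have := j.2
    simp only [Matrix.reindex_apply, Matrix.submatrix_apply, Matrix.transpose_apply,
      Matrix.of_apply, Matrix.vandermonde_apply, shiftedRow, rowLen_bot]
    simp only [Fin.revPerm_symm, Fin.revPerm_apply, Fin.val_rev]
    congr 1
    omega
  rw [h1, Matrix.det_vandermonde, Finset.prod_sigma', vand]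
  refine Finset.prod_bij' (fun p _ => ⟨p.2.rev, p.1.rev⟩) (fun p _ => (p.2.rev, p.1.rev))
    ?_ ?_ ?_ ?_ ?_ <;> simp

theorem schurPoly_bot (N : ℕ) : schurPoly N ⊥ = 1 := by
  rw [schurPoly, alternantQuot_eq_iff, ← vand_eq_alternant, mul_one]

theorem rename_alternant {N : ℕ} (f : Fin N → Polynomial ℂ) (σ : Equiv.Perm (Fin N)) :
    MvPolynomial.rename σ (alternant f) = (Equiv.Perm.sign σ : ℤ) • alternant f := by
  unfold alternant
  rw [zsmul_eq_mul, ← Matrix.det_permute', AlgHom.map_det]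
  congr 1
  ext1 i j
  simp [← Polynomial.aeval_algHom_apply]

theorem rename_vand {N : ℕ} (σ : Equiv.Perm (Fin N)) :
    MvPolynomial.rename σ (vand N) = (Equiv.Perm.sign σ : ℤ) • vand N := by
  rw [vand_eq_alternant, rename_alternant]

theorem rename_alternantQuot {N : ℕ} (f : Fin N → Polynomial ℂ) (σ : Equiv.Perm (Fin N)) :
    MvPolynomial.rename σ (alternantQuot f) = alternantQuot f := by
  have h := congrArg (MvPolynomial.rename σ) (vand_mul_alternantQuot f)
  rw [map_mul, rename_vand, rename_alternant, ← vand_mul_alternantQuot, smul_mul_assoc] at h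
  have h2 := congrArg ((Equiv.Perm.sign σ : ℤ) • ·) h
  simp only [smul_smul, ← Units.val_mul, Int.units_mul_self, Units.val_one, one_smul] at h2
  exact mul_left_cancel₀ (vand_ne_zero N) h2

/-- At zero last variable, the last column is a unit vector: since `ℓ(λ) ≤ N`, the exponent 0 occurs
in the last row and nowhere else. In the remaining minor each exponent is one larger than for `N`
variables, which yields the factor `∏ x_i`. -/
theorem killCompl_alternant_X_pow {N : ℕ} {lam : YoungDiagram} (hN : len lam ≤ N) :
    MvPolynomial.killCompl (Fin.castSucc_injective N)
      (alternant fun i => Polynomial.X ^ shiftedRow (N + 1) lam i : MvPolynomial (Fin (N + 1)) ℂ) =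
    (∏ i, MvPolynomial.X i) * alternant fun i => Polynomial.X ^ shiftedRow N lam i := by
  have hX : ∀ j : Fin N, MvPolynomial.killCompl (R := ℂ) (Fin.castSucc_injective N)
      (MvPolynomial.X j.castSucc) = MvPolynomial.X j := by
    intro j
    have := MvPolynomial.killCompl_rename_app (R := ℂ) (Fin.castSucc_injective N)
      (MvPolynomial.X j)
    rwa [MvPolynomial.rename_X] at this
  have hlast : MvPolynomial.killCompl (R := ℂ) (Fin.castSucc_injective N)
      (MvPolynomial.X (Fin.last N)) = 0 := by
    rw [MvPolynomial.killCompl, MvPolynomial.aeval_X, dif_neg]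
    rintro ⟨j, hj⟩
    exact (Fin.castSucc_lt_last j).ne hj
  rw [alternant_X_pow, alternant_X_pow, AlgHom.map_det, Matrix.det_succ_column _ (Fin.last N),
    Fin.sum_univ_castSucc, Finset.sum_eq_zero, zero_add]
  · have hr : shiftedRow (N + 1) lam (Fin.last N) = 0 := by
      simp [shiftedRow, rowLen_eq_zero hN]
    rw [← Matrix.det_mul_row]
    simp only [AlgHom.mapMatrix_apply, Matrix.map_apply, Matrix.of_apply, hr, pow_zero, map_one,
      mul_one]
    rw [← two_mul, pow_mul, neg_one_sq, one_pow, one_mul]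
    congr 1
    ext1 i j
    have := i.2
    simp only [Matrix.submatrix_apply, Matrix.map_apply, Matrix.of_apply, Fin.succAbove_last,
      map_pow, hX]
    rw [← pow_succ']
    congr 1
    simp only [shiftedRow, Fin.val_castSucc]
    omega
  · intro i _
    have := i.2
    have hpos : shiftedRow (N + 1) lam i.castSucc ≠ 0 := by
      simp only [shiftedRow, Fin.val_castSucc]
      omega
    simp [hlast, hpos]

/-- The Vandermonde determinant is the alternant of `⊥`, so numerator and denominator acquire the
same factor `∏ x_i`. -/
theorem killCompl_schurPoly {N : ℕ} {lam : YoungDiagram} (hN : len lam ≤ N) :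
    MvPolynomial.killCompl (Fin.castSucc_injective N) (schurPoly (N + 1) lam) =
      schurPoly N lam := by
  symm
  rw [schurPoly, alternantQuot_eq_iff]
  have h := congrArg (MvPolynomial.killCompl (Fin.castSucc_injective N))
    (vand_mul_alternantQuot fun i : Fin (N + 1) => Polynomial.X ^ shiftedRow (N + 1) lam i)
  rw [map_mul, killCompl_alternant_X_pow hN, vand_eq_alternant,
    killCompl_alternant_X_pow (by simp), ← vand_eq_alternant, mul_assoc] at h
  refine (mul_left_cancel₀ ?_ h).symm
  exact Finset.prod_ne_zero_iff.mpr fun i _ => MvPolynomial.X_ne_zero i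

theorem isHomogeneous_alternant_X_pow {N : ℕ} (k : Fin N → ℕ) :
    (alternant fun i => Polynomial.X ^ k i).IsHomogeneous (∑ i, k i) := by
  rw [alternant_X_pow, Matrix.det_apply]
  refine MvPolynomial.IsHomogeneous.sum _ _ _ fun σ _ => ?_
  rw [← Equiv.sum_comp σ]
  have : (∏ i, Matrix.of (fun i j : Fin N => (MvPolynomial.X j : MvPolynomial (Fin N) ℂ) ^ k i)
      (σ i) i).IsHomogeneous (∑ i, k (σ i)) := by
    refine MvPolynomial.IsHomogeneous.prod _ _ _ fun i _ => ?_
    exact MvPolynomial.isHomogeneous_X_pow _ _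
  rcases Int.units_eq_one_or (Equiv.Perm.sign σ) with h | h
  · rw [h, one_smul]
    exact this
  · rw [h, Units.neg_smul, one_smul]
    exact this.neg

theorem totalDegree_vand (N : ℕ) : (vand N).totalDegree = ∑ i, shiftedRow N ⊥ i := by
  rw [vand_eq_alternant]
  refine (isHomogeneous_alternant_X_pow _).totalDegree ?_
  rw [← vand_eq_alternant]
  exact vand_ne_zero N

theorem sum_shiftedRow {N : ℕ} {lam : YoungDiagram} (hN : len lam ≤ N) :
    ∑ i, shiftedRow N lam i = lam.card + ∑ i, shiftedRow N ⊥ i := by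
  rw [card_eq_sum_rowLen lam hN, ← Fin.sum_univ_eq_sum_range, ← Finset.sum_add_distrib]
  simp [shiftedRow]

theorem totalDegree_schurPoly_le {N : ℕ} {lam : YoungDiagram} (hN : len lam ≤ N) :
    (schurPoly N lam).totalDegree ≤ lam.card := by
  by_cases h0 : schurPoly N lam = 0
  · simp [h0]
  have h : (vand N * schurPoly N lam).totalDegree = _ := congrArg MvPolynomial.totalDegree
    (vand_mul_alternantQuot fun i : Fin N => Polynomial.X ^ shiftedRow N lam i)
  rw [MvPolynomial.totalDegree_mul_of_isDomain (vand_ne_zero N) h0, totalDegree_vand] at h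
  have h1 := (isHomogeneous_alternant_X_pow (shiftedRow N lam)).totalDegree_le
  have h3 := sum_shiftedRow hN
  omega

theorem exists_schur (lam : YoungDiagram) :
    ∃ F : SymFun, (∀ N, len lam ≤ N → res N F = schurPoly N lam) ∧
      ∀ m : ℕ →₀ ℕ, lam.card < m.degree → MvPowerSeries.coeff m F.1 = 0 :=
  exists_res_eq (fun N => schurPoly N lam) (len lam) lam.card
    (fun _ _ σ => rename_alternantQuot _ σ) (fun _ hN => killCompl_schurPoly hN)
    (fun _ hN => totalDegree_schurPoly_le hN)

/-- The Schur function `s_λ`. -/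
def schur (lam : YoungDiagram) : SymFun := (exists_schur lam).choose

theorem res_schur {N : ℕ} {lam : YoungDiagram} (hN : len lam ≤ N) :
    res N (schur lam) = schurPoly N lam :=
  (exists_schur lam).choose_spec.1 N hN

theorem coeff_schur_eq_zero {lam : YoungDiagram} {m : ℕ →₀ ℕ} (hm : lam.card < m.degree) :
    MvPowerSeries.coeff m (schur lam).1 = 0 :=
  (exists_schur lam).choose_spec.2 m hm

theorem schur_bot : schur ⊥ = 1 := by
  refine eq_of_res_eq (N := 0) (fun m hm => coeff_schur_eq_zero hm) (fun m hm => ?_) ?_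
  · show MvPowerSeries.coeff m 1 = 0
    classical
    rw [MvPowerSeries.coeff_one, if_neg]
    rintro rfl
    simp at hm
  · rw [res_schur (by simp), schurPoly_bot, map_one]

/-- Any antisymmetric polynomial is a combination of alternants of monomials. -/
theorem antisymmetric_eq_sum {N : ℕ} {P : MvPolynomial (Fin N) ℂ}
    (hP : ∀ σ : Equiv.Perm (Fin N), MvPolynomial.rename σ P = (Equiv.Perm.sign σ : ℤ) • P)
    {S : Finset YoungDiagram} (hlen : ∀ lam ∈ S, len lam ≤ N)
    (hS : ∀ lam : YoungDiagram, len lam ≤ N → (∑ i, shiftedRow N lam i) ≤ P.totalDegree →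
      lam ∈ S) :
    P = ∑ lam ∈ S, MvPolynomial.coeff (Finsupp.equivFunOnFinite.symm (shiftedRow N lam)) P •
      alternant (fun i => Polynomial.X ^ shiftedRow N lam i) := by
  have hperm : ∀ (σ : Equiv.Perm (Fin N)) (k : Fin N → ℕ),
      MvPolynomial.coeff (Finsupp.equivFunOnFinite.symm (k ∘ σ)) P =
        (Equiv.Perm.sign σ : ℤ) • MvPolynomial.coeff (Finsupp.equivFunOnFinite.symm k) P := by
    intro σ k
    have h1 := MvPolynomial.coeff_rename_embDomain σ.toEmbedding P
      (Finsupp.equivFunOnFinite.symm (k ∘ σ))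
    have h2 : (Finsupp.equivFunOnFinite.symm (k ∘ σ)).embDomain σ.toEmbedding =
        Finsupp.equivFunOnFinite.symm k := by
      ext i
      have := Finsupp.embDomain_apply_self σ.toEmbedding
        (Finsupp.equivFunOnFinite.symm (k ∘ σ)) (σ.symm i)
      simpa using this
    rw [← h1, h2]
    have := hP σ
    simp only [Equiv.coe_toEmbedding, this]
    rw [MvPolynomial.coeff_smul]
  set B := P.totalDegree + S.sup (fun lam => lam.rowLen 0) + N + 1 with hB
  have hsum : P = ∑ k ∈ Fintype.piFinset (fun _ : Fin N => Finset.range B),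
      MvPolynomial.coeff (Finsupp.equivFunOnFinite.symm k) P •
        ∏ i, (MvPolynomial.X i : MvPolynomial (Fin N) ℂ) ^ k i := by
    conv_lhs => rw [P.as_sum]
    symm
    have hterm : ∀ m : Fin N →₀ ℕ, MvPolynomial.monomial m (MvPolynomial.coeff m P) =
        MvPolynomial.coeff m P • ∏ i, (MvPolynomial.X i : MvPolynomial (Fin N) ℂ) ^ m i := by
      intro m
      rw [MvPolynomial.monomial_eq, MvPolynomial.smul_eq_C_mul, Finsupp.prod_fintype]
      simp
    symm
    refine Finset.sum_of_injOn (fun m : Fin N →₀ ℕ => (m : Fin N → ℕ)) ?_ ?_ ?_ ?_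
    · exact DFunLike.coe_injective.injOn
    · intro m hm
      simp only [SetLike.mem_coe, Fintype.mem_piFinset, Finset.mem_range]
      intro i
      have h1 := MvPolynomial.le_totalDegree hm
      have h2 : m i ≤ m.sum fun _ e => e := Finsupp.le_degree i m
      omega
    · intro k _ hk
      rw [(MvPolynomial.notMem_support_iff).mp, zero_smul]
      intro h
      exact hk ⟨_, h, by simp⟩
    · intro m _
      rw [hterm]
      simp
  conv_lhs => rw [hsum]
  rw [sum_pi_eq_sum_shiftedRow _ S hlen]
  · refine Finset.sum_congr rfl fun lam _ => ?_
    rw [alternant_X_pow, ← Matrix.det_transpose, Matrix.det_apply, Finset.smul_sum,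
      ← Equiv.sum_comp (Equiv.inv _)]
    refine Finset.sum_congr rfl fun τ _ => ?_
    rw [hperm, Equiv.inv_apply, Equiv.Perm.sign_inv, ← Equiv.prod_comp τ, smul_comm,
      smul_assoc, Units.smul_def, smul_comm]
    simp
  · intro lam hlam i
    have h1 := lam.rowLen_anti 0 i (Nat.zero_le _)
    have h2 : lam.rowLen 0 ≤ S.sup fun lam => lam.rowLen 0 :=
      Finset.le_sup (f := fun lam : YoungDiagram => lam.rowLen 0) hlam
    unfold shiftedRow
    omega
  · intro k hk
    simp only [Function.Injective, not_forall] at hk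
    obtain ⟨i, j, h, hij⟩ := hk
    -- Swapping two equal exponents fixes `k` but reverses the sign, so the coefficient is its own
    -- negative.
    have h1 := hperm (Equiv.swap i j) k
    have h2 : k ∘ Equiv.swap i j = k := by
      ext x
      simp only [Function.comp_apply, Equiv.swap_apply_def]
      split_ifs with h3 h4
      · rw [h3, h]
      · rw [h4, h]
      · rfl
    rw [h2, Equiv.Perm.sign_swap hij] at h1
    simp only [Units.val_neg, Units.val_one, neg_smul, one_smul] at h1
    rw [self_eq_neg.mp h1, zero_smul]
  · intro lam τ hlen _ hnot
    rw [hperm, MvPolynomial.coeff_eq_zero_of_totalDegree_lt, smul_zero, zero_smul]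
    by_contra! h
    refine hnot (hS lam hlen (le_trans (le_of_eq ?_) h))
    exact (Finsupp.sum_fintype (Finsupp.equivFunOnFinite.symm (shiftedRow N lam))
      (fun _ e => e) (fun _ => rfl)).symm

/-- The Schur functions span the algebra of symmetric functions. -/
theorem span_schur : Submodule.span ℂ (Set.range schur) = ⊤ := by
  rw [eq_top_iff]
  rintro F -
  obtain ⟨D, hD⟩ := F.2.2
  -- The `D × D` square contains every partition of size at most `D`, which makes the index set `S`
  -- finite.
  obtain ⟨R, -, hR⟩ := exists_rowLen_eq (fun i => if i < D then D else 0)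
    (fun i j hij => by dsimp only; split_ifs <;> omega) D (by simp)
  set S := (subdiagrams R).filter fun lam => len lam ≤ D ∧ lam.card ≤ D with hS
  have hmem : ∀ lam : YoungDiagram, len lam ≤ D → lam.card ≤ D → lam ∈ S := by
    intro lam h1 h2
    refine Finset.mem_filter.mpr ⟨mem_subdiagrams.mpr (le_iff_rowLen_le.mpr fun i => ?_), h1, h2⟩
    rw [hR]
    split_ifs with hi
    · rw [card_eq_sum_rowLen lam h1] at h2
      exact (Finset.single_le_sum (f := lam.rowLen) (fun _ _ => Nat.zero_le _)
        (Finset.mem_range.mpr hi)).trans h2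
    · exact (rowLen_eq_zero (by omega)).le
  have hlen : ∀ lam ∈ S, len lam ≤ D := fun lam h => (Finset.mem_filter.mp h).2.1
  have hcard : ∀ lam ∈ S, lam.card ≤ D := fun lam h => (Finset.mem_filter.mp h).2.2
  -- With as many variables as the degree bound, restriction is faithful (`eq_of_res_eq`), so it
  -- suffices to expand the antisymmetric polynomial `V · res D F`.
  have h := antisymmetric_eq_sum (P := vand D * res D F) (S := S) (fun σ => by
    rw [map_mul, rename_vand, rename_res, smul_mul_assoc]) hlen (fun lam h1 h2 => by
      refine hmem lam h1 ?_
      have h3 := MvPolynomial.totalDegree_mul (vand D) (res D F)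
      have h4 := totalDegree_res_le hD D
      rw [totalDegree_vand] at h3
      rw [sum_shiftedRow h1] at h2
      omega)
  set c : YoungDiagram → ℂ := fun lam => MvPolynomial.coeff
    (Finsupp.equivFunOnFinite.symm (shiftedRow D lam)) (vand D * res D F)
  have hF : F = ∑ lam ∈ S, c lam • schur lam := by
    refine eq_of_res_eq hD (fun m hm => ?_) ?_
    · have hcoe : ((∑ lam ∈ S, c lam • schur lam : SymFun) : MvPowerSeries ℕ ℂ) =
          ∑ lam ∈ S, c lam • (schur lam).1 := by
        rw [AddSubmonoidClass.coe_finsetSum]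
        rfl
      rw [hcoe, map_sum]
      refine Finset.sum_eq_zero fun lam hlam => ?_
      rw [map_smul, coeff_schur_eq_zero ((hcard lam hlam).trans_lt hm), smul_zero]
    · refine mul_left_cancel₀ (vand_ne_zero D) (h.trans ?_)
      rw [map_sum, Finset.mul_sum]
      refine Finset.sum_congr rfl fun lam hlam => ?_
      rw [map_smul, res_schur (hlen lam hlam), mul_smul_comm, schurPoly, vand_mul_alternantQuot]
  rw [hF]
  exact Submodule.sum_mem _ fun lam _ =>
    Submodule.smul_mem _ _ (Submodule.subset_span ⟨lam, rfl⟩)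

/-! ### Univariate Al-Salam--Carlitz polynomials -/

/-- Formal Favard theorem: a three-term recurrence implies orthogonality. -/
theorem orthogonal_of_recurrence {p : ℕ → Polynomial ℂ} {a b : ℕ → ℂ} (ha : a 0 = 0)
    (hrec : ∀ n, Polynomial.X * p n = p (n + 1) + b n • p n + a n • p (n - 1)) (h0 : p 0 = 1)
    {L : Polynomial ℂ →ₗ[ℂ] ℂ} (hL : ∀ n, L (p n) = if n = 0 then 1 else 0) (n m : ℕ) :
    L (p n * p m) = if n = m then ∏ k ∈ Finset.range n, a (k + 1) else 0 := by
  have key : ∀ n m, n ≤ m →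
      L (p n * p m) = if n = m then ∏ k ∈ Finset.range n, a (k + 1) else 0 := by
    intro n
    induction n using Nat.strong_induction_on with
    | _ n ih =>
      intro m hnm
      rcases n with _ | n
      · rw [h0, one_mul, hL]
        simp [eq_comm]
      · have h1 : p (n + 1) * p m = p n * (p (m + 1) + b m • p m + a m • p (m - 1)) -
            b n • (p n * p m) - a n • (p (n - 1) * p m) := by
          rw [← hrec m]
          have : p (n + 1) = Polynomial.X * p n - b n • p n - a n • p (n - 1) := by
            rw [hrec n]
            ring
          rw [this]
          simp only [sub_mul, smul_mul_assoc]
          ring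
        rw [h1]
        simp only [mul_add, mul_smul_comm, map_sub, map_add, map_smul, smul_eq_mul]
        rw [ih n (by omega) (m + 1) (by omega), ih n (by omega) m (by omega),
          ih n (by omega) (m - 1) (by omega), if_neg (by omega), if_neg (by omega)]
        -- At `n = 0` the truncated index `n - 1` is again 0, and `a 0 = 0` removes the spurious
        -- term.
        have h2 : a n * L (p (n - 1) * p m) = 0 := by
          rcases n with _ | n
          · rw [ha, zero_mul]
          · rw [ih _ (by omega) m (by omega), if_neg (by omega), mul_zero]
        rw [h2]
        by_cases hm : n + 1 = m
        · subst hm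
          rw [if_pos (by omega), if_pos rfl, Finset.prod_range_succ]
          ring
        · rw [if_neg (by omega), if_neg hm]
          ring
  rcases le_total n m with h | h
  · exact key n m h
  · rw [mul_comm, key m n h]
    by_cases hnm : n = m
    · subst hnm; rfl
    · rw [if_neg (Ne.symm hnm), if_neg hnm]

theorem newton_monic (c : ℕ → ℂ) (n : ℕ) : (newton c n).Monic :=
  Polynomial.monic_prod_of_monic _ _ fun _ _ => Polynomial.monic_X_sub_C _

theorem natDegree_newton (c : ℕ → ℂ) (n : ℕ) : (newton c n).natDegree = n := by
  rw [newton, Polynomial.natDegree_prod_of_monic _ _ fun i _ => Polynomial.monic_X_sub_C _]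
  simp

theorem newton_succ (c : ℕ → ℂ) (n : ℕ) :
    newton c (n + 1) = newton c n * (Polynomial.X - Polynomial.C (c n)) :=
  Finset.prod_range_succ _ _

/-- A unitriangular combination of Newton polynomials is again of exact degree. -/
theorem degree_sum_newton {A : ℕ → ℕ → ℂ} (hA1 : ∀ n, A n n = 1) (c : ℕ → ℂ) (n : ℕ) :
    (∑ m ∈ Finset.range (n + 1), A n m • newton c m).degree = n := by
  have h1 : (newton c n).degree = n := by
    rw [Polynomial.degree_eq_natDegree (newton_monic c n).ne_zero, natDegree_newton]
  rw [Finset.sum_range_succ, hA1, one_smul, Polynomial.degree_add_eq_right_of_degree_lt, h1]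
  rw [h1]
  refine lt_of_le_of_lt (Polynomial.degree_sum_le _ _) ?_
  refine (Finset.sup_lt_iff (WithBot.bot_lt_coe n)).mpr fun m hm => ?_
  refine lt_of_le_of_lt (Polynomial.degree_smul_le _ _) ?_
  rw [Polynomial.degree_eq_natDegree (newton_monic c m).ne_zero, natDegree_newton]
  exact WithBot.coe_lt_coe.mpr (Finset.mem_range.mp hm)

/-- A polynomial sequence of exact degrees starting with `1` has a moment functional. -/
theorem exists_moment {p : ℕ → Polynomial ℂ} (hp : ∀ n, (p n).degree = n) :
    ∃ L : Polynomial ℂ →ₗ[ℂ] ℂ, ∀ n, L (p n) = if n = 0 then 1 else 0 := by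
  let S : Polynomial.Sequence ℂ := ⟨p, hp⟩
  have hS : ∀ i, IsUnit (S i).leadingCoeff := fun i =>
    (Polynomial.leadingCoeff_ne_zero.mpr (S.ne_zero i)).isUnit
  refine ⟨(S.basis hS).coord 0, fun n => ?_⟩
  have h : (S.basis hS) n = p n := S.basis_eq_self hS n
  rw [← h, Module.Basis.coord_apply, Module.Basis.repr_self, Finsupp.single_apply]

section
variable {q : ℝ}

theorem one_sub_qpow_ne_zero (hq0 : 0 < q) (hq1 : q < 1) (n : ℕ) :
    1 - (q : ℂ) * (q : ℂ) ^ n ≠ 0 := by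
  rw [← pow_succ']
  have h : q ^ (n + 1) < 1 := pow_lt_one₀ hq0.le hq1 (by omega)
  intro h0
  have : ((1 - q ^ (n + 1) : ℝ) : ℂ) = 0 := by push_cast; exact h0
  rw [Complex.ofReal_eq_zero] at this
  linarith

theorem invQPoch_of_neg {k : ℤ} (hk : k < 0) : invQPoch q k = 0 := if_pos hk

@[simp] theorem invQPoch_zero : invQPoch q 0 = 1 := by simp [invQPoch]

/-- Valid for every integer: at `k = -1` the factor `1 - q^0` vanishes, and below that both sides
are zero. The recurrence can thus be checked without separating boundary indices. -/
theorem invQPoch_pred (hq0 : 0 < q) (hq1 : q < 1) (k : ℤ) :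
    invQPoch q k = invQPoch q (k + 1) * (1 - (q : ℂ) ^ (k + 1)) := by
  have hq : (q : ℂ) ≠ 0 := by exact_mod_cast hq0.ne'
  rcases lt_trichotomy k (-1) with h | h | h
  · rw [invQPoch_of_neg (by omega), invQPoch_of_neg (by omega), zero_mul]
  · subst h
    rw [invQPoch_of_neg (by omega)]
    simp
  · lift k to ℕ using by omega
    have h1 : ((k : ℤ) + 1).toNat = k + 1 := by omega
    rw [invQPoch, invQPoch, if_neg (by omega), if_neg (by omega), h1, Int.toNat_natCast,
      Finset.prod_range_succ, mul_inv, zpow_add_one₀ hq, zpow_natCast, mul_assoc,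
      mul_comm ((q : ℂ) ^ k), inv_mul_cancel₀ (one_sub_qpow_ne_zero hq0 hq1 k), mul_one]

/-- The normalization `(ty)ⁿ q^{-n(n-1)/2} (q; q)_n`. -/
def ascScale (q : ℝ) (t y : ℂ) (n : ℕ) : ℂ :=
  ∏ k ∈ Finset.range n, (t * y * (q : ℂ) ^ (-(k : ℤ)) * (1 - (q : ℂ) * (q : ℂ) ^ k))

theorem ascScale_succ (t y : ℂ) (n : ℕ) : ascScale q t y (n + 1) =
    ascScale q t y n * (t * y * (q : ℂ) ^ (-(n : ℤ)) * (1 - (q : ℂ) * (q : ℂ) ^ n)) :=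
  Finset.prod_range_succ _ _

theorem ascScale_ne_zero (hq0 : 0 < q) (hq1 : q < 1) {t y : ℂ} (ht : t ≠ 0) (hy : y ≠ 0) (n : ℕ) :
    ascScale q t y n ≠ 0 := by
  have hq : (q : ℂ) ≠ 0 := by exact_mod_cast hq0.ne'
  exact Finset.prod_ne_zero_iff.mpr fun k _ =>
    mul_ne_zero (mul_ne_zero (mul_ne_zero ht hy) (zpow_ne_zero _ hq))
      (one_sub_qpow_ne_zero hq0 hq1 k)

/-- The coefficients of the univariate Al-Salam--Carlitz polynomials in the Newton basis. -/
def ascCoeff (q : ℝ) (t y : ℂ) (n m : ℕ) : ℂ :=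
  ascScale q t y n * (ascScale q t y m)⁻¹ * invQPoch q ((n : ℤ) - m)

theorem ascCoeff_of_lt (t y : ℂ) (n m : ℕ) (h : n < m) : ascCoeff q t y n m = 0 := by
  rw [ascCoeff, invQPoch_of_neg (by omega), mul_zero]

theorem ascCoeff_self (hq0 : 0 < q) (hq1 : q < 1) {t y : ℂ} (ht : t ≠ 0) (hy : y ≠ 0) (n : ℕ) :
    ascCoeff q t y n n = 1 := by
  rw [ascCoeff, sub_self, invQPoch_zero, mul_one,
    mul_inv_cancel₀ (ascScale_ne_zero hq0 hq1 ht hy n)]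

/-- The nodes `y, y q⁻¹, y q⁻², …`. -/
def qNode (q : ℝ) (y : ℂ) (m : ℕ) : ℂ := y * (q : ℂ) ^ (-(m : ℤ))

/-- The univariate Al-Salam--Carlitz polynomials. -/
def ascPoly (q : ℝ) (t y : ℂ) (n : ℕ) : Polynomial ℂ :=
  ∑ m ∈ Finset.range (n + 1), ascCoeff q t y n m • newton (qNode q y) m

/-- The ratio of successive norms of the Al-Salam--Carlitz polynomials. -/
def ascNormRatio (q : ℝ) (t y : ℂ) (n : ℕ) : ℂ :=
  -t * y ^ 2 * (q : ℂ) ^ (1 - 2 * (n : ℤ)) * (1 - (q : ℂ) ^ n)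

/-- Rewrites the `n - 1` term with the normalization of index `n`, so that all terms of the
recurrence share one factor. It includes `n = 0`, where `1 - q^0 = 0` on the left and the negative
index on the right make both sides zero. -/
theorem ascNormRatio_mul_ascCoeff (hq0 : 0 < q) (t y : ℂ) (n m : ℕ) : ascNormRatio q t y n * ascCoeff q t y (n - 1) m =
      -(y * (q : ℂ) ^ (-(n : ℤ))) * (ascScale q t y n * (ascScale q t y m)⁻¹) *
        invQPoch q ((n : ℤ) - m - 1) := by
  have hq : (q : ℂ) ≠ 0 := by exact_mod_cast hq0.ne'
  rcases n with _ | n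
  · rw [invQPoch_of_neg (by omega)]
    simp [ascNormRatio]
  · rw [ascCoeff, ascScale_succ, ascNormRatio, Nat.add_sub_cancel]
    have h1 : ((n + 1 : ℕ) : ℤ) - m - 1 = (n : ℤ) - m := by push_cast; ring
    rw [h1]
    have h2 : (q : ℂ) ^ (1 - 2 * ((n + 1 : ℕ) : ℤ)) =
        (q : ℂ) ^ (-((n + 1 : ℕ) : ℤ)) * (q : ℂ) ^ (-(n : ℤ)) := by
      rw [← zpow_add₀ hq]
      congr 1
      push_cast
      ring
    rw [h2]
    ring

/-- This compares the coefficients of the Newton polynomial of index `m + 1` in the three-term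
recurrence. With `k = n - m - 1`, every reciprocal `q`-factorial is a multiple of `1/(q;q)_{k+1}`,
and a rational identity in `q`, `q^k`, `q^m` remains. -/
theorem ascCoeff_recurrence (hq0 : 0 < q) (hq1 : q < 1) {t y : ℂ} (ht : t ≠ 0) (hy : y ≠ 0)
    (n m : ℕ) :
    ascCoeff q t y n m + qNode q y (m + 1) * ascCoeff q t y n (m + 1) =
      ascCoeff q t y (n + 1) (m + 1) +
        y * (q : ℂ) ^ (-(n : ℤ)) * (1 - t) * ascCoeff q t y n (m + 1) +
        ascNormRatio q t y n * ascCoeff q t y (n - 1) (m + 1) := by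
  have hq : (q : ℂ) ≠ 0 := by exact_mod_cast hq0.ne'
  rw [ascNormRatio_mul_ascCoeff hq0]
  unfold ascCoeff qNode
  rw [ascScale_succ t y n, ascScale_succ t y m]
  have hm := ascScale_ne_zero hq0 hq1 ht hy m
  have hm1 := one_sub_qpow_ne_zero hq0 hq1 m
  obtain ⟨k, hk⟩ : ∃ k : ℤ, k = (n : ℤ) - (m + 1 : ℕ) := ⟨_, rfl⟩
  have e1 : (n : ℤ) - m = k + 1 := by rw [hk]; push_cast; ring
  have e2 : ((n + 1 : ℕ) : ℤ) - (m + 1 : ℕ) = k + 1 := by rw [hk]; push_cast; ring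
  rw [e1, e2, ← hk, invQPoch_pred hq0 hq1 (k - 1), sub_add_cancel, invQPoch_pred hq0 hq1 k]
  have e3 : (q : ℂ) ^ n = (q : ℂ) ^ (k + 1) * (q : ℂ) ^ m := by
    rw [← zpow_natCast, ← zpow_natCast, ← zpow_add₀ hq, ← e1]
    congr 1
    ring
  have e4 : (q : ℂ) ^ (-(n : ℤ)) = ((q : ℂ) ^ n)⁻¹ := by rw [zpow_neg, zpow_natCast]
  have e5 : (q : ℂ) ^ (-(m : ℤ)) = ((q : ℂ) ^ m)⁻¹ := by rw [zpow_neg, zpow_natCast]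
  have e6 : (q : ℂ) ^ (-((m + 1 : ℕ) : ℤ)) = ((q : ℂ) * (q : ℂ) ^ m)⁻¹ := by
    rw [zpow_neg, zpow_natCast, pow_succ']
  have e7 : (q : ℂ) ^ (k + 1) = (q : ℂ) ^ k * q := zpow_add_one₀ hq k
  rw [e4, e5, e6, e3, e7]
  have hQ : (q : ℂ) ^ k ≠ 0 := zpow_ne_zero _ hq
  have hM : (q : ℂ) ^ m ≠ 0 := pow_ne_zero _ hq
  generalize (q : ℂ) ^ k = Q at *
  generalize (q : ℂ) ^ m = M at *
  generalize invQPoch q (k + 1) = B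
  generalize ascScale q t y n = U
  generalize ascScale q t y m = V at *
  generalize (q : ℂ) = x at *
  field_simp
  ring

theorem ascCoeff_recurrence_zero (hq0 : 0 < q) (hq1 : q < 1) {t y : ℂ} (ht : t ≠ 0) (hy : y ≠ 0)
    (n : ℕ) :
    qNode q y 0 * ascCoeff q t y n 0 =
      ascCoeff q t y (n + 1) 0 +
        y * (q : ℂ) ^ (-(n : ℤ)) * (1 - t) * ascCoeff q t y n 0 +
        ascNormRatio q t y n * ascCoeff q t y (n - 1) 0 := by
  have hq : (q : ℂ) ≠ 0 := by exact_mod_cast hq0.ne'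
  rw [ascNormRatio_mul_ascCoeff hq0]
  unfold ascCoeff qNode
  rw [ascScale_succ t y n]
  have h0 := ascScale_ne_zero hq0 hq1 ht hy 0
  have e2 : ((n + 1 : ℕ) : ℤ) - (0 : ℕ) = n + 1 := by push_cast; ring
  have e1 : (n : ℤ) - (0 : ℕ) = n := by push_cast; ring
  rw [e1, e2, invQPoch_pred hq0 hq1 (n - 1), sub_add_cancel, invQPoch_pred hq0 hq1 n,
    zpow_add_one₀ hq, zpow_neg _ (n : ℤ), zpow_natCast, Nat.cast_zero, neg_zero, zpow_zero]
  have hM : (q : ℂ) ^ n ≠ 0 := pow_ne_zero _ hq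
  generalize (q : ℂ) ^ n = M at *
  generalize invQPoch q ((n : ℤ) + 1) = B
  generalize ascScale q t y n = U
  generalize ascScale q t y 0 = V at *
  generalize (q : ℂ) = x at *
  field_simp
  ring

/-- Multiplication by `X` sends the Newton polynomial of index `m` to that of index `m + 1` plus
`qNode q y m` times itself, so the claim reduces to the two coefficient identities. It is the
recurrence of the Al-Salam--Carlitz polynomials of the second kind with parameter `-t`, rescaled by
`y`. -/
theorem ascPoly_recurrence (hq0 : 0 < q) (hq1 : q < 1) {t y : ℂ} (ht : t ≠ 0) (hy : y ≠ 0)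
    (n : ℕ) :
    Polynomial.X * ascPoly q t y n = ascPoly q t y (n + 1) +
      (y * (q : ℂ) ^ (-(n : ℤ)) * (1 - t)) • ascPoly q t y n +
      ascNormRatio q t y n • ascPoly q t y (n - 1) := by
  have hext : ∀ k, k ≤ n + 1 → ascPoly q t y k =
      ∑ m ∈ Finset.range (n + 1 + 1), ascCoeff q t y k m • newton (qNode q y) m := by
    intro k hk
    refine Finset.sum_subset (fun m hm => ?_) fun m _ hm => ?_
    · simp only [Finset.mem_range] at hm ⊢
      omega
    · rw [ascCoeff_of_lt _ _ _ _ (by simpa [Nat.lt_succ_iff] using hm), zero_smul]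
  have h1 : Polynomial.X * ascPoly q t y n =
      ∑ m ∈ Finset.range (n + 1), ascCoeff q t y n m • newton (qNode q y) (m + 1) +
      ∑ m ∈ Finset.range (n + 1 + 1), (qNode q y m * ascCoeff q t y n m) • newton (qNode q y) m := by
    rw [Finset.sum_range_succ _ (n + 1), ascCoeff_of_lt _ _ n (n + 1) (by omega), mul_zero,
      zero_smul, add_zero, ← Finset.sum_add_distrib, ascPoly, Finset.mul_sum]
    refine Finset.sum_congr rfl fun m _ => ?_
    rw [newton_succ]
    simp only [Polynomial.smul_eq_C_mul, map_mul]
    ring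
  rw [h1, hext n (by omega), hext (n + 1) le_rfl, hext (n - 1) (by omega), Finset.smul_sum,
    Finset.smul_sum]
  rw [Finset.sum_range_succ' _ (n + 1), Finset.sum_range_succ' _ (n + 1),
    Finset.sum_range_succ' _ (n + 1), Finset.sum_range_succ' _ (n + 1)]
  rw [← add_assoc, ← Finset.sum_add_distrib]
  have hz := congrArg (fun z => z • newton (qNode q y) 0)
    (ascCoeff_recurrence_zero hq0 hq1 ht hy n)
  have hs := Finset.sum_congr (rfl : Finset.range (n + 1) = Finset.range (n + 1)) fun m _ =>
    congrArg (fun z => z • newton (qNode q y) (m + 1)) (ascCoeff_recurrence hq0 hq1 ht hy n m)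
  simp only [add_smul, Finset.sum_add_distrib, mul_smul] at hz hs ⊢
  rw [hz, hs]
  abel

theorem ascPoly_zero (hq0 : 0 < q) (hq1 : q < 1) {t y : ℂ} (ht : t ≠ 0) (hy : y ≠ 0) :
    ascPoly q t y 0 = 1 := by
  simp [ascPoly, ascCoeff_self hq0 hq1 ht hy, newton]

/-- Orthogonality of the univariate Al-Salam--Carlitz polynomials. -/
theorem exists_ascPoly_orthogonal (hq0 : 0 < q) (hq1 : q < 1) {t y : ℂ} (ht : t ≠ 0)
    (hy : y ≠ 0) : ∃ L : Polynomial ℂ →ₗ[ℂ] ℂ, ∀ n m, L (ascPoly q t y n * ascPoly q t y m) =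
      if n = m then ∏ k ∈ Finset.range n, ascNormRatio q t y (k + 1) else 0 := by
  obtain ⟨L, hL⟩ := exists_moment (p := ascPoly q t y)
    (degree_sum_newton (ascCoeff_self hq0 hq1 ht hy) _)
  exact ⟨L, orthogonal_of_recurrence (by simp [ascNormRatio])
    (ascPoly_recurrence hq0 hq1 ht hy) (ascPoly_zero hq0 hq1 ht hy) hL⟩

end

/-! ### Orthogonality of alternants -/

/-- The `N`-fold tensor power of a linear functional on univariate polynomials. -/
def tensorFunctional (L : Polynomial ℂ →ₗ[ℂ] ℂ) (N : ℕ) : MvPolynomial (Fin N) ℂ →ₗ[ℂ] ℂ :=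
  (MvPolynomial.basisMonomials (Fin N) ℂ).constr ℂ fun m => ∏ i, L (Polynomial.X ^ m i)

theorem tensorFunctional_prod (L : Polynomial ℂ →ₗ[ℂ] ℂ) {N : ℕ} (f : Fin N → Polynomial ℂ) :
    tensorFunctional L N (∏ i, Polynomial.aeval (MvPolynomial.X i) (f i)) = ∏ i, L (f i) := by
  obtain ⟨B, hB⟩ : ∃ B, ∀ i, (f i).natDegree < B :=
    ⟨Finset.univ.sup (fun i => (f i).natDegree) + 1, fun i => Nat.lt_succ_of_le
      (Finset.le_sup (f := fun i => (f i).natDegree) (Finset.mem_univ i))⟩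
  have hf : ∀ i, f i = ∑ k ∈ Finset.range B, (f i).coeff k • Polynomial.X ^ k := by
    intro i
    conv_lhs => rw [(f i).as_sum_range' B (hB i)]
    simp only [Polynomial.smul_X_eq_monomial]
  have h1 : ∀ i, Polynomial.aeval (MvPolynomial.X i : MvPolynomial (Fin N) ℂ) (f i) =
      ∑ k ∈ Finset.range B, (f i).coeff k • (MvPolynomial.X i : MvPolynomial (Fin N) ℂ) ^ k := by
    intro i
    conv_lhs => rw [hf i]
    simp
  have h2 : ∀ i, L (f i) = ∑ k ∈ Finset.range B, (f i).coeff k * L (Polynomial.X ^ k) := by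
    intro i
    conv_lhs => rw [hf i]
    simp
  simp only [h1, h2]
  rw [Finset.prod_univ_sum, Finset.prod_univ_sum, map_sum]
  refine Finset.sum_congr rfl fun k _ => ?_
  rw [Finset.prod_smul, map_smul, Finset.prod_mul_distrib, smul_eq_mul]
  congr 1
  have h3 : ∏ i, (MvPolynomial.X i : MvPolynomial (Fin N) ℂ) ^ k i =
      MvPolynomial.basisMonomials (Fin N) ℂ (Finsupp.equivFunOnFinite.symm k) := by
    rw [MvPolynomial.coe_basisMonomials]
    dsimp only
    rw [MvPolynomial.monomial_eq, Finsupp.prod_fintype]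
    · simp
    · simp
  rw [h3, tensorFunctional, Module.Basis.constr_basis]
  rfl

theorem alternant_eq_sum {N : ℕ} (f : Fin N → Polynomial ℂ) :
    alternant f = ∑ σ : Equiv.Perm (Fin N),
      (Equiv.Perm.sign σ : ℤ) • ∏ i, Polynomial.aeval (MvPolynomial.X i) (f (σ i)) := by
  rw [alternant, Matrix.det_apply]
  rfl

open scoped Classical in
-- After expanding both determinants, each term factors over the variables and vanishes unless the
-- permuted index sequences coincide, that is unless `λ = μ` and `σ = τ`. The `N!` surviving terms
-- are equal, their signs being squared.
theorem tensorFunctional_alternant_mul {L : Polynomial ℂ →ₗ[ℂ] ℂ} {P : ℕ → Polynomial ℂ}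
    {h : ℕ → ℂ} (hL : ∀ n m, L (P n * P m) = if n = m then h n else 0) {N : ℕ}
    {lam mu : YoungDiagram} (hlam : len lam ≤ N) (hmu : len mu ≤ N) :
    tensorFunctional L N (alternant (fun i => P (shiftedRow N lam i)) *
      alternant (fun i => P (shiftedRow N mu i))) =
      if lam = mu then (N.factorial : ℂ) * ∏ i, h (shiftedRow N lam i) else 0 := by
  have hterm : ∀ σ τ : Equiv.Perm (Fin N),
      tensorFunctional L N (((Equiv.Perm.sign σ : ℤ) •
          ∏ i, Polynomial.aeval (MvPolynomial.X i) (P (shiftedRow N lam (σ i)))) *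
        ((Equiv.Perm.sign τ : ℤ) •
          ∏ i, Polynomial.aeval (MvPolynomial.X i) (P (shiftedRow N mu (τ i))))) =
      if lam = mu ∧ σ = τ then ∏ i, h (shiftedRow N lam i) else 0 := by
    intro σ τ
    rw [smul_mul_smul_comm, ← Finset.prod_mul_distrib]
    simp only [← map_mul]
    rw [map_zsmul, tensorFunctional_prod L
      (fun i => P (shiftedRow N lam (σ i)) * P (shiftedRow N mu (τ i)))]
    simp only [hL]
    split_ifs with hc
    · obtain ⟨rfl, rfl⟩ := hc
      simp only [if_true]
      rw [← Units.val_mul, Int.units_mul_self, Units.val_one, one_smul,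
        Equiv.prod_comp σ fun i => h (shiftedRow N lam i)]
    · have : ∃ i, shiftedRow N lam (σ i) ≠ shiftedRow N mu (τ i) := by
        by_contra! hall
        exact hc (shiftedRow_comp_injective hlam hmu (funext hall))
      obtain ⟨i, hi⟩ := this
      rw [Finset.prod_eq_zero (Finset.mem_univ i) (if_neg hi), smul_zero]
  rw [alternant_eq_sum, alternant_eq_sum, Finset.sum_mul_sum]
  simp only [map_sum, hterm]
  split_ifs with hlm
  · simp [hlm, Fintype.card_perm]
  · simp [hlm]

/-- The normalized functional `F ↦ L^{⊗N}(F V²) / Z` on symmetric functions. -/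
def symFunctional (L : Polynomial ℂ →ₗ[ℂ] ℂ) (N : ℕ) (Z : ℂ) : SymFun →ₗ[ℂ] ℂ :=
  Z⁻¹ • (tensorFunctional L N ∘ₗ LinearMap.mulLeft ℂ (vand N * vand N) ∘ₗ (res N).toLinearMap)

theorem symFunctional_apply (L : Polynomial ℂ →ₗ[ℂ] ℂ) (N : ℕ) (Z : ℂ) (F : SymFun) :
    symFunctional L N Z F = Z⁻¹ * tensorFunctional L N (vand N * vand N * res N F) := rfl

open scoped Classical in
theorem symFunctional_mul {L : Polynomial ℂ →ₗ[ℂ] ℂ} {P : ℕ → Polynomial ℂ}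
    {h : ℕ → ℂ} (hL : ∀ n m, L (P n * P m) = if n = m then h n else 0) (hh : ∀ n, h n ≠ 0) {N : ℕ}
    {lam mu : YoungDiagram} (hlam : len lam ≤ N) (hmu : len mu ≤ N) {F G : SymFun}
    (hF : res N F = alternantQuot fun i => P (shiftedRow N lam i))
    (hG : res N G = alternantQuot fun i => P (shiftedRow N mu i)) :
    symFunctional L N ((N.factorial : ℂ) * ∏ i, h (shiftedRow N ⊥ i)) (F * G) =
      if lam = mu then ∏ i, (h (shiftedRow N lam i) / h (shiftedRow N ⊥ i)) else 0 := by
  have hfac : (N.factorial : ℂ) ≠ 0 := by exact_mod_cast N.factorial_ne_zero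
  have hprod : ∏ i, h (shiftedRow N ⊥ i) ≠ 0 := Finset.prod_ne_zero_iff.mpr fun i _ => hh _
  have h1 : vand N * vand N * res N (F * G) =
      alternant (fun i => P (shiftedRow N lam i)) * alternant (fun i => P (shiftedRow N mu i)) := by
    rw [map_mul, hF, hG, ← vand_mul_alternantQuot, ← vand_mul_alternantQuot]
    ring
  rw [symFunctional_apply, h1, tensorFunctional_alternant_mul hL hlam hmu]
  split_ifs
  · rw [Finset.prod_div_distrib]
    field_simp
  · rw [mul_zero]

/-! ### Content sums -/

theorem sum_cells_eq {M : Type*} [AddCommMonoid M] (lam : YoungDiagram) {N : ℕ}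
    (hN : len lam ≤ N) (f : ℕ → ℕ → M) :
    ∑ x ∈ lam.cells, f x.1 x.2 =
      ∑ i ∈ Finset.range N, ∑ j ∈ Finset.range (lam.rowLen i), f i j := by
  rw [Finset.sum_sigma']
  refine Finset.sum_bij' (fun x _ => ⟨x.1, x.2⟩) (fun x _ => (x.1, x.2)) ?_ ?_ ?_ ?_ ?_
  · rintro ⟨i, j⟩ hx
    have h1 : j < lam.rowLen i := YoungDiagram.mem_iff_lt_rowLen.mp hx
    have h2 : i < N := by
      by_contra hi
      rw [rowLen_eq_zero (i := i) (by omega)] at h1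
      omega
    simp [h1, h2]
  · rintro ⟨i, j⟩ hx
    simp only [Finset.mem_sigma, Finset.mem_range] at hx
    exact YoungDiagram.mem_iff_lt_rowLen.mpr hx.2
  · intros; rfl
  · intros; rfl
  · intros; rfl

theorem nStat_eq_sum_cells (lam : YoungDiagram) : nStat lam = ∑ x ∈ lam.cells, x.1 := by
  rw [sum_cells_eq lam le_rfl fun i _ => i, nStat]
  exact Finset.sum_congr rfl fun i _ => by simp [mul_comm]

theorem nStat_transpose_eq_sum_cells (lam : YoungDiagram) :
    nStat lam.transpose = ∑ x ∈ lam.cells, x.2 := by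
  rw [nStat_eq_sum_cells]
  refine Finset.sum_bij' (fun x _ => x.swap) (fun x _ => x.swap) ?_ ?_ ?_ ?_ ?_
  · intro x hx
    exact YoungDiagram.mem_transpose.mp hx
  · intro x hx
    refine YoungDiagram.mem_transpose.mpr ?_
    rw [Prod.swap_swap]
    exact hx
  all_goals intros; simp

/-- The negated content sum `n(λ) - n(λ')`. -/
def coContent (lam : YoungDiagram) : ℤ := (nStat lam : ℤ) - nStat lam.transpose

theorem coContent_eq_sum (lam : YoungDiagram) {N : ℕ} (hN : len lam ≤ N) :
    coContent lam =
      ∑ i ∈ Finset.range N, ∑ j ∈ Finset.range (lam.rowLen i), ((i : ℤ) - j) := by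
  rw [← sum_cells_eq lam hN fun i j => ((i : ℤ) - j), coContent, nStat_eq_sum_cells,
    nStat_transpose_eq_sum_cells]
  push_cast
  rw [Finset.sum_sub_distrib]

theorem zpow_sum {x : ℂ} (hx : x ≠ 0) {ι : Type*} (s : Finset ι) (f : ι → ℤ) :
    x ^ (∑ i ∈ s, f i) = ∏ i ∈ s, x ^ f i := by
  classical
  induction s using Finset.induction_on with
  | empty => simp
  | insert a s ha ih => rw [Finset.sum_insert ha, Finset.prod_insert ha, zpow_add₀ hx, ih]

section
variable {q : ℝ}

/-! ### Products over rows -/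

/-- The ratio `(q; q)_{M + l} / (q; q)_M`. -/
def qRatio (q : ℝ) (l M : ℕ) : ℂ := ∏ k ∈ Finset.range l, (1 - (q : ℂ) * (q : ℂ) ^ (M + k))

/-- The product of `(q; q)_{λ_i + N - i} / (q; q)_{N - i}` over all rows. -/
def rowRatio (q : ℝ) (N : ℕ) (lam : YoungDiagram) : ℂ :=
  ∏ i ∈ Finset.range N, qRatio q (lam.rowLen i) (N - 1 - i)

theorem rowRatio_ne_zero (hq0 : 0 < q) (hq1 : q < 1) (N : ℕ) (lam : YoungDiagram) :
    rowRatio q N lam ≠ 0 :=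
  Finset.prod_ne_zero_iff.mpr fun _ _ => Finset.prod_ne_zero_iff.mpr fun _ _ =>
    one_sub_qpow_ne_zero hq0 hq1 _

theorem tendsto_qpow (hq0 : 0 < q) (hq1 : q < 1) :
    Filter.Tendsto (fun n : ℕ => (q : ℂ) ^ n) Filter.atTop (𝓝 0) :=
  tendsto_pow_atTop_nhds_zero_of_norm_lt_one (by
    rw [Complex.norm_real, Real.norm_of_nonneg hq0.le]
    exact hq1)

/-- Empty rows contribute 1, so the number of factors is fixed, and each is `1 - q^r` with `r → ∞`.
-/
theorem tendsto_rowRatio (hq0 : 0 < q) (hq1 : q < 1) (lam : YoungDiagram) :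
    Filter.Tendsto (fun N => rowRatio q N lam) Filter.atTop (𝓝 1) := by
  have h1 : ∀ l i : ℕ, Filter.Tendsto (fun N : ℕ => qRatio q l (N - 1 - i)) Filter.atTop (𝓝 1) := by
    intro l i
    have h2 : ∀ k : ℕ, Filter.Tendsto (fun N : ℕ => 1 - (q : ℂ) * (q : ℂ) ^ (N - 1 - i + k))
        Filter.atTop (𝓝 1) := by
      intro k
      have h3 : Filter.Tendsto (fun N : ℕ => N - 1 - i + k) Filter.atTop Filter.atTop :=
        Filter.tendsto_atTop_mono (fun N => Nat.le_add_right _ k)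
          ((Filter.tendsto_sub_atTop_nat i).comp (Filter.tendsto_sub_atTop_nat 1))
      have h4 := ((tendsto_qpow hq0 hq1).comp h3).const_mul (q : ℂ)
      simpa using h4.const_sub 1
    have h5 := tendsto_finsetProd (Finset.range l) fun k _ => h2 k
    rw [Finset.prod_const_one] at h5
    exact h5
  have h2 := tendsto_finsetProd (Finset.range (len lam)) fun i _ => h1 (lam.rowLen i) i
  rw [Finset.prod_const_one] at h2
  refine h2.congr' ?_
  filter_upwards [Filter.eventually_ge_atTop (len lam)] with N hN
  refine Finset.prod_subset (fun i hi => ?_) fun i _ hi => ?_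
  · simp only [Finset.mem_range] at hi ⊢
    omega
  · rw [rowLen_eq_zero (by simpa using hi)]
    simp [qRatio]

/-- A common form of the normalizations and of the norms of Al-Salam--Carlitz polynomials. -/
def qScale (q : ℝ) (s : ℂ) (e N n : ℕ) : ℂ :=
  ∏ k ∈ Finset.range n,
    (s * ((q : ℂ) ^ ((N : ℤ) - 1 - k)) ^ e * (1 - (q : ℂ) * (q : ℂ) ^ k))

theorem qScale_ne_zero (hq0 : 0 < q) (hq1 : q < 1) {s : ℂ} (hs : s ≠ 0) (e N n : ℕ) :
    qScale q s e N n ≠ 0 := by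
  have hq : (q : ℂ) ≠ 0 := by exact_mod_cast hq0.ne'
  exact Finset.prod_ne_zero_iff.mpr fun k _ =>
    mul_ne_zero (mul_ne_zero hs (pow_ne_zero _ (zpow_ne_zero _ hq)))
      (one_sub_qpow_ne_zero hq0 hq1 k)

/-- Substituting `k = N - 1 - i + j` turns the exponent `N - 1 - k` into `i - j`, the negated
content of the cell `(i, j)`. The dependence on `N` of the added factors is thus confined to
`qRatio`. -/
theorem qScale_add (hq0 : 0 < q) (s : ℂ) (e : ℕ) {N i : ℕ} (hi : i < N) (l : ℕ) :
    qScale q s e N (l + (N - 1 - i)) = qScale q s e N (N - 1 - i) *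
      (s ^ l * ((q : ℂ) ^ (∑ j ∈ Finset.range l, ((i : ℤ) - j))) ^ e * qRatio q l (N - 1 - i)) := by
  have hq : (q : ℂ) ≠ 0 := by exact_mod_cast hq0.ne'
  rw [add_comm l, qScale, Finset.prod_range_add]
  congr 1
  rw [zpow_sum hq, ← Finset.prod_pow, qRatio, Finset.prod_mul_distrib, Finset.prod_mul_distrib,
    Finset.prod_const, Finset.card_range]
  congr 2
  refine Finset.prod_congr rfl fun k _ => ?_
  congr 2
  omega

theorem prod_qScale_div (hq0 : 0 < q) (hq1 : q < 1) {s : ℂ} (hs : s ≠ 0) (e : ℕ) {N : ℕ}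
    {lam : YoungDiagram} (hN : len lam ≤ N) :
    ∏ i, (qScale q s e N (shiftedRow N lam i) / qScale q s e N (shiftedRow N ⊥ i)) =
      s ^ lam.card * ((q : ℂ) ^ coContent lam) ^ e * rowRatio q N lam := by
  have hq : (q : ℂ) ≠ 0 := by exact_mod_cast hq0.ne'
  have h1 : ∀ i : Fin N,
      qScale q s e N (shiftedRow N lam i) / qScale q s e N (shiftedRow N ⊥ i) =
      (fun i : ℕ => s ^ lam.rowLen i *
        ((q : ℂ) ^ (∑ j ∈ Finset.range (lam.rowLen i), ((i : ℤ) - j))) ^ e *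
          qRatio q (lam.rowLen i) (N - 1 - i)) i := by
    intro i
    have h2 : shiftedRow N ⊥ i = N - 1 - i := by simp [shiftedRow]
    rw [h2, shiftedRow, qScale_add hq0 s e i.2, mul_div_cancel_left₀]
    exact qScale_ne_zero hq0 hq1 hs _ _ _
  rw [Finset.prod_congr rfl fun i _ => h1 i, Fin.prod_univ_eq_prod_range (fun i : ℕ =>
    s ^ lam.rowLen i * ((q : ℂ) ^ (∑ j ∈ Finset.range (lam.rowLen i), ((i : ℤ) - j))) ^ e *
      qRatio q (lam.rowLen i) (N - 1 - i)) N,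
    Finset.prod_mul_distrib, Finset.prod_mul_distrib, Finset.prod_pow_eq_pow_sum,
    ← card_eq_sum_rowLen lam hN, Finset.prod_pow, ← zpow_sum hq, ← coContent_eq_sum lam hN]
  rfl

/-! ### The coefficients of Al-Salam--Carlitz functions in the interpolation functions -/

theorem ascScale_eq_qScale (hq0 : 0 < q) (t : ℂ) (N n : ℕ) :
    ascScale q t ((q : ℂ) ^ ((N : ℤ) - 1)) n = qScale q t 1 N n := by
  have hq : (q : ℂ) ≠ 0 := by exact_mod_cast hq0.ne'
  refine Finset.prod_congr rfl fun k _ => ?_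
  rw [pow_one, sub_eq_add_neg _ (k : ℤ), zpow_add₀ hq]
  ring

theorem prod_ascNormRatio_eq_qScale (hq0 : 0 < q) (t : ℂ) (N n : ℕ) :
    ∏ k ∈ Finset.range n, ascNormRatio q t ((q : ℂ) ^ ((N : ℤ) - 1)) (k + 1) =
      qScale q (-t / q) 2 N n := by
  have hq : (q : ℂ) ≠ 0 := by exact_mod_cast hq0.ne'
  refine Finset.prod_congr rfl fun k _ => ?_
  have h1 : (1 - 2 * ((k + 1 : ℕ) : ℤ)) = -(k : ℤ) + -(k : ℤ) - 1 := by push_cast; ring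
  rw [ascNormRatio, h1, sub_eq_add_neg _ (k : ℤ), zpow_add₀ hq _ (-(k : ℤ)), zpow_sub_one₀ hq (-(k : ℤ) + -(k : ℤ)),
    zpow_add₀ hq, pow_succ' (q : ℂ) k]
  ring

theorem shiftedMinor_mul (u v : ℕ → ℂ) (B : ℕ → ℕ → ℂ) (N : ℕ) (lam mu : YoungDiagram) :
    shiftedMinor (fun n m => u n * v m * B n m) N lam mu =
      (∏ i, u (shiftedRow N lam i)) * (∏ i, v (shiftedRow N mu i)) * shiftedMinor B N lam mu := by
  unfold shiftedMinor
  have h := Matrix.det_mul_column (fun i => u (shiftedRow N lam i))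
    (Matrix.of fun i j : Fin N => v (shiftedRow N mu j) *
      (Matrix.of fun i j : Fin N => B (shiftedRow N lam i) (shiftedRow N mu j)) i j)
  rw [Matrix.det_mul_row] at h
  rw [mul_assoc, ← h]
  congr 1
  ext1 i j
  simp [mul_assoc]

theorem shiftedMinor_invQPoch {N : ℕ} {lam mu : YoungDiagram} (hN : len lam ≤ N)
    (hmu : mu ≤ lam) :
    shiftedMinor (fun n m => invQPoch q ((n : ℤ) - m)) N lam mu =
      Matrix.det (Matrix.of fun j k : Fin (len lam) =>
        invQPoch q ((lam.rowLen j : ℤ) - (j : ℤ) - (mu.rowLen k : ℤ) + (k : ℤ))) := by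
  rw [shiftedMinor_eq_det (fun n m h => invQPoch_of_neg (by omega)) (fun n => by simp) hN hmu]
  congr 1
  ext1 i j
  simp only [Matrix.of_apply]
  congr 1
  have := i.2
  have := j.2
  omega

/-- The array is `1/(q;q)_{n-m}` with rows and columns rescaled by `ascScale`, so the scales leave
the determinant as products over rows, evaluated by `prod_qScale_div`. The staircase parts common to
`λ` and `μ` cancel. -/
theorem shiftedMinor_ascCoeff (hq0 : 0 < q) (hq1 : q < 1) {t : ℂ} (ht : t ≠ 0) {N : ℕ}
    {lam mu : YoungDiagram} (hN : len lam ≤ N) (hmu : mu ≤ lam) :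
    shiftedMinor (ascCoeff q t ((q : ℂ) ^ ((N : ℤ) - 1))) N lam mu =
      t ^ ((lam.card : ℤ) - mu.card) * (q : ℂ) ^ (coContent lam - coContent mu) *
      Matrix.det (Matrix.of fun j k : Fin (len lam) =>
        invQPoch q ((lam.rowLen j : ℤ) - (j : ℤ) - (mu.rowLen k : ℤ) + (k : ℤ))) *
      (rowRatio q N lam / rowRatio q N mu) := by
  have hq : (q : ℂ) ≠ 0 := by exact_mod_cast hq0.ne'
  have h1 : shiftedMinor (ascCoeff q t ((q : ℂ) ^ ((N : ℤ) - 1))) N lam mu = _ :=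
    shiftedMinor_mul (ascScale q t ((q : ℂ) ^ ((N : ℤ) - 1)))
      (fun m => (ascScale q t ((q : ℂ) ^ ((N : ℤ) - 1)) m)⁻¹)
      (fun n m => invQPoch q ((n : ℤ) - m)) N lam mu
  have h2 := prod_qScale_div hq0 hq1 ht 1 hN
  have h3 := prod_qScale_div hq0 hq1 ht 1 ((len_mono hmu).trans hN)
  rw [Finset.prod_div_distrib, pow_one] at h2 h3
  have h4 : ∏ i, qScale q t 1 N (shiftedRow N ⊥ i) ≠ 0 :=
    Finset.prod_ne_zero_iff.mpr fun i _ => qScale_ne_zero hq0 hq1 ht _ _ _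
  rw [div_eq_iff h4] at h2 h3
  simp only [ascScale_eq_qScale hq0, Finset.prod_inv_distrib] at h1
  rw [h1, shiftedMinor_invQPoch hN hmu, h2, h3, zpow_sub₀ ht, zpow_sub₀ hq, zpow_natCast,
    zpow_natCast]
  have h5 := rowRatio_ne_zero hq0 hq1 N mu
  have h6 : (q : ℂ) ^ coContent mu ≠ 0 := zpow_ne_zero _ hq
  field_simp

theorem tendsto_sigma (hq0 : 0 < q) (hq1 : q < 1) {c d : ℂ} (hc : c ≠ 0) (hd : d ≠ 0)
    {lam mu : YoungDiagram} (hmu : mu ≤ lam) :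
    Filter.Tendsto (fun N : ℕ => c ^ (-(lam.card : ℤ)) *
      shiftedMinor (ascCoeff q (-c / d) ((q : ℂ) ^ ((N : ℤ) - 1))) N lam mu)
      Filter.atTop (𝓝 (sigmaASC q c d lam mu)) := by
  have ht : -c / d ≠ 0 := div_ne_zero (neg_ne_zero.mpr hc) hd
  have h1 := (tendsto_rowRatio hq0 hq1 lam).div (tendsto_rowRatio hq0 hq1 mu) one_ne_zero
  rw [div_one] at h1
  have h2 := h1.const_mul (sigmaASC q c d lam mu)
  rw [mul_one] at h2
  refine h2.congr' ?_
  filter_upwards [Filter.eventually_ge_atTop (len lam)] with N hN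
  rw [shiftedMinor_ascCoeff hq0 hq1 ht hN hmu, sigmaASC]
  have h3 : (nStat mu.transpose : ℤ) - nStat mu - nStat lam.transpose + nStat lam =
      coContent lam - coContent mu := by
    unfold coContent
    ring
  rw [h3, Pi.div_apply]
  ring

theorem sigmaASC_self (c d : ℂ) (lam : YoungDiagram) :
    sigmaASC q c d lam lam = c ^ (-(lam.card : ℤ)) := by
  rw [sigmaASC, sub_self, zpow_zero, mul_one]
  have h3 : (nStat lam.transpose : ℤ) - nStat lam - nStat lam.transpose + nStat lam = 0 := by
    ring
  rw [h3, zpow_zero, mul_one, ← shiftedMinor_invQPoch le_rfl le_rfl, shiftedMinor_self, mul_one]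
  · intro n m h
    exact invQPoch_of_neg (by omega)
  · simp

/-! ### The coefficients of interpolation functions in Schur functions -/

/-- The `(M + k)`-fold Newton polynomials with geometric nodes have convergent `M`-th
coefficients. -/
theorem exists_tendsto_coeff_newton (hq0 : 0 < q) (hq1 : q < 1) (C : ℂ) (k : ℕ) :
    ∃ l, Filter.Tendsto (fun M => (newton (fun s => C * (q : ℂ) ^ s) (M + k)).coeff M)
      Filter.atTop (𝓝 l) := by
  induction k with
  | zero =>
    refine ⟨1, tendsto_const_nhds.congr fun M => ?_⟩
    have h := newton_monic (fun s => C * (q : ℂ) ^ s) M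
    rw [Polynomial.Monic, Polynomial.leadingCoeff, natDegree_newton] at h
    exact h.symm
  | succ k ih =>
    obtain ⟨l, hl⟩ := ih
    obtain ⟨K, hK⟩ := Metric.isBounded_range_of_tendsto _ hl |>.exists_norm_le
    refine cauchySeq_tendsto_of_complete
      (cauchySeq_of_le_geometric q (‖C‖ * K) hq1 fun M => ?_)
    -- Splitting off the last node shows that consecutive terms differ by `C q^(M+1+k)` times a
    -- coefficient from the case `k`, which is bounded by `K`; the sequence is geometrically Cauchy.
    have hrec : (newton (fun s => C * (q : ℂ) ^ s) (M + 1 + (k + 1))).coeff (M + 1) =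
        (newton (fun s => C * (q : ℂ) ^ s) (M + (k + 1))).coeff M -
        C * (q : ℂ) ^ (M + 1 + k) *
          (newton (fun s => C * (q : ℂ) ^ s) (M + 1 + k)).coeff (M + 1) := by
      rw [← add_assoc (M + 1) k 1, newton_succ, mul_sub, Polynomial.coeff_sub,
        Polynomial.coeff_mul_X, Polynomial.coeff_mul_C, add_right_comm M 1 k, ← add_assoc M k 1]
      ring
    have hK' := hK _ ⟨M + 1, rfl⟩
    have hqM : ‖(q : ℂ) ^ (M + 1 + k)‖ ≤ q ^ M := by
      rw [norm_pow, Complex.norm_real, Real.norm_of_nonneg hq0.le]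
      exact pow_le_pow_of_le_one hq0.le hq1.le (by omega)
    rw [hrec, dist_eq_norm, sub_sub_cancel, norm_mul, norm_mul]
    calc ‖C‖ * ‖(q : ℂ) ^ (M + 1 + k)‖ * _ ≤ ‖C‖ * q ^ M * K := by
          gcongr
      _ = ‖C‖ * K * q ^ M := by ring

/-- The coefficients of Newton polynomials in powers. -/
def newtonCoeff (c : ℕ → ℂ) (n m : ℕ) : ℂ := (newton c n).coeff m

theorem newtonCoeff_of_lt (c : ℕ → ℂ) (n m : ℕ) (h : n < m) : newtonCoeff c n m = 0 :=
  Polynomial.coeff_eq_zero_of_natDegree_lt (by rwa [natDegree_newton])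

theorem newtonCoeff_self (c : ℕ → ℂ) (n : ℕ) : newtonCoeff c n n = 1 := by
  have h := newton_monic c n
  rwa [Polynomial.Monic, Polynomial.leadingCoeff, natDegree_newton] at h

theorem newton_eq_sum (c : ℕ → ℂ) (n : ℕ) :
    newton c n = ∑ m ∈ Finset.range (n + 1), newtonCoeff c n m • Polynomial.X ^ m := by
  conv_lhs => rw [(newton c n).as_sum_range' (n + 1) (by rw [natDegree_newton]; omega)]
  simp only [Polynomial.smul_X_eq_monomial]
  rfl

/-- Read backwards, the nodes are a geometric progression of ratio `q` whose starting point
`q^(i+1-a)` does not depend on `N`. Increasing `N` only appends nodes tending to 0. -/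
theorem newton_qNode_eq (hq0 : 0 < q) {N i : ℕ} (hi : i < N) (a : ℕ) :
    newton (qNode q ((q : ℂ) ^ ((N : ℤ) - 1))) (a + (N - 1 - i)) =
      newton (fun s => (q : ℂ) ^ ((i : ℤ) + 1 - a) * (q : ℂ) ^ s) (a + (N - 1 - i)) := by
  have hq : (q : ℂ) ≠ 0 := by exact_mod_cast hq0.ne'
  unfold newton
  rw [← Finset.prod_range_reflect]
  refine Finset.prod_congr rfl fun s hs => ?_
  rw [Finset.mem_range] at hs
  congr 2
  dsimp only
  rw [qNode, ← zpow_add₀ hq, ← zpow_natCast, ← zpow_add₀ hq]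
  congr 1
  omega

/-- For large `N` the gap between degree and coefficient index is the constant `a + j - b - i`. If
it is negative the coefficient is zero. -/
theorem exists_tendsto_newtonCoeff (hq0 : 0 < q) (hq1 : q < 1) (a b i j : ℕ) :
    ∃ l, Filter.Tendsto (fun N : ℕ => newtonCoeff (qNode q ((q : ℂ) ^ ((N : ℤ) - 1)))
      (a + (N - 1 - i)) (b + (N - 1 - j))) Filter.atTop (𝓝 l) := by
  by_cases h : b + i ≤ a + j
  · obtain ⟨k, hk⟩ := Nat.exists_eq_add_of_le h
    obtain ⟨l, hl⟩ := exists_tendsto_coeff_newton hq0 hq1 ((q : ℂ) ^ ((i : ℤ) + 1 - a)) k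
    have h1 : Filter.Tendsto (fun N : ℕ => b + (N - 1 - j)) Filter.atTop Filter.atTop :=
      Filter.tendsto_atTop_mono (fun N => Nat.le_add_left _ b)
        ((Filter.tendsto_sub_atTop_nat j).comp (Filter.tendsto_sub_atTop_nat 1))
    refine ⟨l, (hl.comp h1).congr' ?_⟩
    filter_upwards [Filter.eventually_gt_atTop i, Filter.eventually_gt_atTop j] with N hi hj
    rw [newtonCoeff, newton_qNode_eq hq0 hi, Function.comp_apply]
    congr 2
    omega
  · refine ⟨0, tendsto_const_nhds.congr' ?_⟩
    filter_upwards [Filter.eventually_gt_atTop i, Filter.eventually_gt_atTop j] with N hi hj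
    exact (newtonCoeff_of_lt _ _ _ (by omega)).symm

theorem exists_tendsto_shiftedMinor_newtonCoeff (hq0 : 0 < q) (hq1 : q < 1)
    {lam mu : YoungDiagram} (hmu : mu ≤ lam) :
    ∃ l, Filter.Tendsto (fun N : ℕ =>
      shiftedMinor (newtonCoeff (qNode q ((q : ℂ) ^ ((N : ℤ) - 1)))) N lam mu)
      Filter.atTop (𝓝 l) := by
  choose l hl using fun i j : Fin (len lam) =>
    exists_tendsto_newtonCoeff hq0 hq1 (lam.rowLen i) (mu.rowLen j) i j
  have h1 : Filter.Tendsto (fun N : ℕ => (Matrix.of fun i j : Fin (len lam) =>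
      newtonCoeff (qNode q ((q : ℂ) ^ ((N : ℤ) - 1)))
        (lam.rowLen i + (N - 1 - (i : ℕ))) (mu.rowLen j + (N - 1 - (j : ℕ)))))
      Filter.atTop (𝓝 (Matrix.of l)) :=
    tendsto_pi_nhds.mpr fun i => tendsto_pi_nhds.mpr fun j => hl i j
  refine ⟨_, (((continuous_id.matrix_det).tendsto (Matrix.of l)).comp h1).congr' ?_⟩
  filter_upwards [Filter.eventually_ge_atTop (len lam)] with N hN
  exact (shiftedMinor_eq_det (newtonCoeff_of_lt _) (newtonCoeff_self _) hN hmu).symm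

end

/-! ### Sequences of symmetric functions with convergent coefficients -/

/-- `F_N → F`, where `F_N` is a fixed finite combination of symmetric functions with convergent
coefficients. -/
inductive CoeffTendsto : (ℕ → SymFun) → SymFun → Prop
  | smul {a : ℕ → ℂ} {a₀ : ℂ} (h : Filter.Tendsto a Filter.atTop (𝓝 a₀)) (G : SymFun) :
      CoeffTendsto (fun N => a N • G) (a₀ • G)
  | add {F G : ℕ → SymFun} {F₀ G₀ : SymFun} (hF : CoeffTendsto F F₀) (hG : CoeffTendsto G G₀) :
      CoeffTendsto (fun N => F N + G N) (F₀ + G₀)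

namespace CoeffTendsto

theorem const (G : SymFun) : CoeffTendsto (fun _ => G) G := by
  simpa using CoeffTendsto.smul (tendsto_const_nhds (x := (1 : ℂ))) G

theorem sum {ι : Type*} (s : Finset ι) {F : ι → ℕ → SymFun} {F₀ : ι → SymFun}
    (h : ∀ i ∈ s, CoeffTendsto (F i) (F₀ i)) :
    CoeffTendsto (fun N => ∑ i ∈ s, F i N) (∑ i ∈ s, F₀ i) := by
  classical
  induction s using Finset.induction_on with
  | empty => simpa using const 0
  | insert a s ha ih =>
    simp only [Finset.sum_insert ha]
    exact (h a (Finset.mem_insert_self a s)).add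
      (ih fun i hi => h i (Finset.mem_insert_of_mem hi))

theorem smul_seq {a : ℕ → ℂ} {a₀ : ℂ} (ha : Filter.Tendsto a Filter.atTop (𝓝 a₀))
    {F : ℕ → SymFun} {F₀ : SymFun} (hF : CoeffTendsto F F₀) :
    CoeffTendsto (fun N => a N • F N) (a₀ • F₀) := by
  induction hF with
  | smul hb G =>
    simp only [smul_smul]
    exact .smul (ha.mul hb) G
  | add _ _ ih1 ih2 =>
    simp only [smul_add]
    exact ih1.add ih2

theorem mul {F G : ℕ → SymFun} {F₀ G₀ : SymFun} (hF : CoeffTendsto F F₀)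
    (hG : CoeffTendsto G G₀) : CoeffTendsto (fun N => F N * G N) (F₀ * G₀) := by
  induction hF with
  | smul ha A =>
    induction hG with
    | smul hb B =>
      simp only [smul_mul_smul_comm]
      exact .smul (ha.mul hb) _
    | add _ _ ih1 ih2 =>
      simp only [mul_add]
      exact ih1.add ih2
  | add _ _ ih1 ih2 =>
    simp only [add_mul]
    exact ih1.add ih2

/-- Pointwise convergence of the varying functionals suffices because all `F N` lie in the span of
one fixed finite family. -/
theorem map {F : ℕ → SymFun} {F₀ : SymFun} (hF : CoeffTendsto F F₀) {E : ℕ → SymFun →ₗ[ℂ] ℂ}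
    {E₀ : SymFun →ₗ[ℂ] ℂ} (hE : ∀ G, Filter.Tendsto (fun N => E N G) Filter.atTop (𝓝 (E₀ G))) :
    Filter.Tendsto (fun N => E N (F N)) Filter.atTop (𝓝 (E₀ F₀)) := by
  induction hF with
  | smul ha G =>
    simp only [map_smul, smul_eq_mul]
    exact ha.mul (hE G)
  | add _ _ ih1 ih2 =>
    simp only [map_add]
    exact ih1.add ih2

theorem exists_degree_bound {F : ℕ → SymFun} {F₀ : SymFun} (hF : CoeffTendsto F F₀) :
    ∃ D : ℕ, ∀ N, ∀ m : ℕ →₀ ℕ, D < m.degree → MvPowerSeries.coeff m (F N).1 = 0 := by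
  induction hF with
  | @smul a _ _ G =>
    obtain ⟨D, hD⟩ := G.2.2
    refine ⟨D, fun N m hm => ?_⟩
    show MvPowerSeries.coeff m (a N • G.1) = 0
    rw [map_smul, hD m hm, smul_zero]
  | @add A B _ _ _ _ ih1 ih2 =>
    obtain ⟨D, hD⟩ := ih1
    obtain ⟨E, hE⟩ := ih2
    refine ⟨max D E, fun N m hm => ?_⟩
    show MvPowerSeries.coeff m ((A N).1 + (B N).1) = 0
    rw [map_add, hD N m (lt_of_le_of_lt (le_max_left _ _) hm),
      hE N m (lt_of_le_of_lt (le_max_right _ _) hm), add_zero]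

/-- Each fixed monomial is eventually supported in the first `N` variables, where restriction does
not change its coefficient. -/
theorem convergesTo {F : ℕ → SymFun} {F₀ : SymFun} (hF : CoeffTendsto F F₀)
    {P : (N : ℕ) → MvPolynomial (Fin N) ℂ} {N₀ : ℕ} (hP : ∀ N, N₀ ≤ N → P N = res N (F N))
    (hP0 : ∀ N, N < N₀ → P N = 0) : ConvergesTo P F₀ := by
  constructor
  · obtain ⟨D, hD⟩ := hF.exists_degree_bound
    refine ⟨D, fun N => ?_⟩
    rcases le_or_gt N₀ N with h | h
    · rw [hP N h]
      exact totalDegree_res_le (hD N) N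
    · simp [hP0 N h]
  · intro m
    have h1 := hF.map (E := fun _ => (MvPowerSeries.coeff m).comp (Subalgebra.val SymFun).toLinearMap)
      (fun G => tendsto_const_nhds)
    refine h1.congr' ?_
    filter_upwards [eventually_support_lt m, Filter.eventually_ge_atTop N₀] with N hm hN
    rw [hP N hN, coeff_rename_res hm]
    rfl

end CoeffTendsto

/-! ### Triangular arrays indexed by diagrams -/

theorem card_lt_of_lt {mu lam : YoungDiagram} (h : mu < lam) : mu.card < lam.card :=
  Finset.card_lt_card (YoungDiagram.cells_ssubset_iff.mpr h)

open scoped Classical in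
/-- The finite set of all `μ ⊊ λ`. -/
def properSubdiagrams (lam : YoungDiagram) : Finset YoungDiagram := (subdiagrams lam).erase lam

@[simp] theorem card_bot : (⊥ : YoungDiagram).card = 0 := rfl

@[simp] theorem nStat_bot : nStat ⊥ = 0 := by simp [nStat]

@[simp] theorem nStat_transpose_bot : nStat (⊥ : YoungDiagram).transpose = 0 := by
  rw [nStat_transpose_eq_sum_cells]
  rfl

theorem mem_properSubdiagrams {mu lam : YoungDiagram} :
    mu ∈ properSubdiagrams lam ↔ mu < lam := by
  classical
  rw [properSubdiagrams, Finset.mem_erase, mem_subdiagrams, lt_iff_le_and_ne, and_comm]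

theorem sum_subdiagrams_eq {M : Type*} [AddCommMonoid M] (lam : YoungDiagram)
    (f : YoungDiagram → M) :
    ∑ mu ∈ subdiagrams lam, f mu = f lam + ∑ mu ∈ properSubdiagrams lam, f mu := by
  classical
  exact (Finset.add_sum_erase _ _ (mem_subdiagrams.mpr le_rfl)).symm

theorem subdiagrams_bot : subdiagrams ⊥ = {⊥} := by
  ext mu
  rw [mem_subdiagrams, Finset.mem_singleton, le_bot_iff]

/-- Convergence can be inverted through a unitriangular array. -/
theorem exists_tendsto_of_triangular {x y : YoungDiagram → ℕ → ℂ}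
    {K : YoungDiagram → YoungDiagram → ℕ → ℂ}
    (hK : ∀ lam mu, mu ≤ lam → ∃ l, Filter.Tendsto (K lam mu) Filter.atTop (𝓝 l))
    (hK1 : ∀ lam N, K lam lam N = 1)
    (hy : ∀ lam, ∃ l, Filter.Tendsto (y lam) Filter.atTop (𝓝 l))
    (hxy : ∀ lam, ∀ᶠ N in Filter.atTop, y lam N = ∑ mu ∈ subdiagrams lam, K lam mu N * x mu N)
    (lam : YoungDiagram) : ∃ l, Filter.Tendsto (x lam) Filter.atTop (𝓝 l) := by
  induction hn : lam.card using Nat.strong_induction_on generalizing lam with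
  | _ n ih =>
    have hlow : ∀ mu ∈ properSubdiagrams lam,
        ∃ l, Filter.Tendsto (fun N => K lam mu N * x mu N) Filter.atTop (𝓝 l) := by
      intro mu hmu
      rw [mem_properSubdiagrams] at hmu
      obtain ⟨l1, h1⟩ := hK lam mu hmu.le
      obtain ⟨l2, h2⟩ := ih mu.card (hn ▸ card_lt_of_lt hmu) mu rfl
      exact ⟨_, h1.mul h2⟩
    choose! l hl using hlow
    obtain ⟨l0, hl0⟩ := hy lam
    refine ⟨_, (hl0.sub (tendsto_finsetSum _ hl)).congr' ?_⟩
    filter_upwards [hxy lam] with N hN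
    rw [hN, sum_subdiagrams_eq, hK1]
    ring

/-- Induction on `|λ|`: the diagonal coefficient is invertible and the other terms involve strictly
smaller diagrams. -/
theorem mem_span_of_triangular {V : Type*} [AddCommGroup V] [Module ℂ V] {f g : YoungDiagram → V}
    {K : YoungDiagram → YoungDiagram → ℂ} (hK : ∀ lam, K lam lam ≠ 0)
    (hg : ∀ lam, g lam = ∑ mu ∈ subdiagrams lam, K lam mu • f mu) (lam : YoungDiagram) :
    f lam ∈ Submodule.span ℂ (Set.range g) := by
  induction hn : lam.card using Nat.strong_induction_on generalizing lam with
  | _ n ih =>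
    have h1 : f lam = (K lam lam)⁻¹ •
        (g lam - ∑ mu ∈ properSubdiagrams lam, K lam mu • f mu) := by
      rw [hg, sum_subdiagrams_eq, add_sub_cancel_right, inv_smul_smul₀ (hK lam)]
    rw [h1]
    refine Submodule.smul_mem _ _ (Submodule.sub_mem _ (Submodule.subset_span ⟨lam, rfl⟩)
      (Submodule.sum_mem _ fun mu hmu => Submodule.smul_mem _ _ ?_))
    exact ih mu.card (hn ▸ card_lt_of_lt (mem_properSubdiagrams.mp hmu)) mu rfl

/-! ### Interpolation functions -/

section
variable {q : ℝ}

/-- The coefficients of `I^A_{λ|N}` in the Schur polynomials. -/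
def interpCoeff (q : ℝ) (lam mu : YoungDiagram) (N : ℕ) : ℂ :=
  shiftedMinor (newtonCoeff (qNode q ((q : ℂ) ^ ((N : ℤ) - 1)))) N lam mu

theorem interpCoeff_self (lam : YoungDiagram) (N : ℕ) : interpCoeff q lam lam N = 1 :=
  shiftedMinor_self (newtonCoeff_of_lt _) (newtonCoeff_self _) N lam

/-- The lift of `I^A_{λ|N}` to the algebra of symmetric functions. -/
def interpSeq (q : ℝ) (lam : YoungDiagram) (N : ℕ) : SymFun :=
  ∑ mu ∈ subdiagrams lam, interpCoeff q lam mu N • schur mu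

theorem interpA_eq (hq0 : 0 < q) {lam : YoungDiagram} {N : ℕ} (hN : len lam ≤ N) :
    interpA q lam N = alternantQuot fun i : Fin N =>
      newton (qNode q ((q : ℂ) ^ ((N : ℤ) - 1))) (shiftedRow N lam i) := by
  have hq : (q : ℂ) ≠ 0 := by exact_mod_cast hq0.ne'
  have h1 : (fun i : ℕ => (q : ℂ) ^ ((N : ℤ) - 1 - (i : ℤ))) =
      qNode q ((q : ℂ) ^ ((N : ℤ) - 1)) := by
    ext1 i
    rw [qNode, sub_eq_add_neg _ (i : ℤ), zpow_add₀ hq]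
  rw [interpA, multiSchur, if_pos hN, h1]
  rfl

theorem res_interpSeq (hq0 : 0 < q) {lam : YoungDiagram} {N : ℕ} (hN : len lam ≤ N) :
    res N (interpSeq q lam N) = interpA q lam N := by
  rw [interpA_eq hq0 hN, alternantQuot_triangular (newtonCoeff_of_lt _) (newton_eq_sum _) hN,
    interpSeq, map_sum]
  refine Finset.sum_congr rfl fun mu hmu => ?_
  rw [map_smul, res_schur ((len_mono (mem_subdiagrams.mp hmu)).trans hN)]
  rfl

theorem convergesTo_interpA (hq0 : 0 < q) {lam : YoungDiagram} {F : SymFun}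
    (h : CoeffTendsto (interpSeq q lam) F) : ConvergesTo (interpA q lam) F :=
  h.convergesTo (N₀ := len lam) (fun N hN => (res_interpSeq hq0 hN).symm) fun N hN => by
    rw [interpA, multiSchur, if_neg (by omega)]

/-- The interpolation functions are unitriangular combinations of Schur functions. -/
theorem exists_interpCoeff_limit (hq0 : 0 < q) (hq1 : q < 1) :
    ∃ D : YoungDiagram → YoungDiagram → ℂ, (∀ lam, D lam lam = 1) ∧
      (∀ lam, IA q lam = ∑ mu ∈ subdiagrams lam, D lam mu • schur mu) ∧
      (∀ lam, CoeffTendsto (interpSeq q lam) (IA q lam)) := by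
  choose! D hD using fun (lam mu : YoungDiagram) (h : mu ≤ lam) =>
    exists_tendsto_shiftedMinor_newtonCoeff hq0 hq1 h
  have h1 : ∀ lam, CoeffTendsto (interpSeq q lam)
      (∑ mu ∈ subdiagrams lam, D lam mu • schur mu) := fun lam =>
    CoeffTendsto.sum _ fun mu hmu => .smul (hD lam mu (mem_subdiagrams.mp hmu)) _
  have h2 : ∀ lam, IA q lam = ∑ mu ∈ subdiagrams lam, D lam mu • schur mu := fun lam =>
    symLim_eq (convergesTo_interpA hq0 (h1 lam))
  refine ⟨D, fun lam => ?_, h2, fun lam => (h2 lam).symm ▸ h1 lam⟩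
  refine tendsto_nhds_unique (hD lam lam le_rfl) ?_
  exact tendsto_const_nhds.congr fun N => (interpCoeff_self lam N).symm

theorem interpSeq_bot (N : ℕ) : interpSeq q ⊥ N = 1 := by
  rw [interpSeq, subdiagrams_bot, Finset.sum_singleton, interpCoeff_self, one_smul, schur_bot]

theorem IA_bot (hq0 : 0 < q) : IA q ⊥ = 1 := by
  refine symLim_eq (convergesTo_interpA hq0 ?_)
  have h : interpSeq q ⊥ = fun _ => 1 := funext interpSeq_bot
  rw [h]
  exact CoeffTendsto.const 1

/-! ### Finite-variable Al-Salam--Carlitz polynomials -/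

/-- The coefficients of the `N`-variate Al-Salam--Carlitz polynomials in the interpolation
polynomials. -/
def ascMinor (q : ℝ) (t : ℂ) (lam mu : YoungDiagram) (N : ℕ) : ℂ :=
  shiftedMinor (ascCoeff q t ((q : ℂ) ^ ((N : ℤ) - 1))) N lam mu

theorem ascMinor_self (hq0 : 0 < q) (hq1 : q < 1) {t : ℂ} (ht : t ≠ 0) (lam : YoungDiagram)
    (N : ℕ) : ascMinor q t lam lam N = 1 :=
  shiftedMinor_self (ascCoeff_of_lt _ _) (ascCoeff_self hq0 hq1 ht
    (zpow_ne_zero _ (by exact_mod_cast hq0.ne'))) N lam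

/-- The lift of the monic `N`-variate Al-Salam--Carlitz polynomial to symmetric functions. -/
def ascSeq (q : ℝ) (t : ℂ) (lam : YoungDiagram) (N : ℕ) : SymFun :=
  ∑ mu ∈ subdiagrams lam, ascMinor q t lam mu N • interpSeq q mu N

theorem res_ascSeq (hq0 : 0 < q) (t : ℂ) {lam : YoungDiagram} {N : ℕ} (hN : len lam ≤ N) :
    res N (ascSeq q t lam N) =
      alternantQuot fun i => ascPoly q t ((q : ℂ) ^ ((N : ℤ) - 1)) (shiftedRow N lam i) := by
  rw [alternantQuot_triangular (Q := ascPoly q t ((q : ℂ) ^ ((N : ℤ) - 1)))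
    (ascCoeff_of_lt _ _) (fun n => rfl) hN, ascSeq, map_sum]
  refine Finset.sum_congr rfl fun mu hmu => ?_
  have hmu' := (len_mono (mem_subdiagrams.mp hmu)).trans hN
  rw [map_smul, res_interpSeq hq0 hmu', interpA_eq hq0 hmu']
  rfl

theorem ascSeq_bot (hq0 : 0 < q) (hq1 : q < 1) {t : ℂ} (ht : t ≠ 0) (N : ℕ) :
    ascSeq q t ⊥ N = 1 := by
  rw [ascSeq, subdiagrams_bot, Finset.sum_singleton, ascMinor_self hq0 hq1 ht, one_smul,
    interpSeq_bot]

open scoped Classical in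
/-- Orthogonality of the `N`-variate Al-Salam--Carlitz polynomials. -/
theorem exists_ascSeq_orthogonal (hq0 : 0 < q) (hq1 : q < 1) {t : ℂ} (ht : t ≠ 0) (N : ℕ) :
    ∃ E : SymFun →ₗ[ℂ] ℂ, ∀ lam mu : YoungDiagram, len lam ≤ N → len mu ≤ N →
      E (ascSeq q t lam N * ascSeq q t mu N) = if lam = mu then
        (-t / q) ^ lam.card * ((q : ℂ) ^ coContent lam) ^ 2 * rowRatio q N lam else 0 := by
  have hq : (q : ℂ) ≠ 0 := by exact_mod_cast hq0.ne'
  have hs : -t / q ≠ 0 := div_ne_zero (neg_ne_zero.mpr ht) hq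
  obtain ⟨L, hL⟩ := exists_ascPoly_orthogonal hq0 hq1 ht (zpow_ne_zero ((N : ℤ) - 1) hq)
  simp only [prod_ascNormRatio_eq_qScale hq0] at hL
  refine ⟨symFunctional L N ((N.factorial : ℂ) *
    ∏ i, qScale q (-t / q) 2 N (shiftedRow N ⊥ i)), fun lam mu hlam hmu => ?_⟩
  have h := symFunctional_mul hL (qScale_ne_zero hq0 hq1 hs 2 N) hlam hmu
    (res_ascSeq hq0 t hlam) (res_ascSeq hq0 t hmu)
  rw [prod_qScale_div hq0 hq1 hs 2 hlam] at h
  exact h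

/-! ### The limit -/

/-- The Al-Salam--Carlitz function before the dilation of the variables. -/
def ascFun (q : ℝ) (c d : ℂ) (lam : YoungDiagram) : SymFun :=
  ∑ mu ∈ subdiagrams lam, sigmaASC q c d lam mu • IA q mu

theorem coeffTendsto_ascSeq (hq0 : 0 < q) (hq1 : q < 1) {c d : ℂ} (hc : c ≠ 0) (hd : d ≠ 0)
    (lam : YoungDiagram) :
    CoeffTendsto (fun N => c ^ (-(lam.card : ℤ)) • ascSeq q (-c / d) lam N)
      (ascFun q c d lam) := by
  obtain ⟨D, -, -, hI⟩ := exists_interpCoeff_limit hq0 hq1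
  simp only [ascSeq, Finset.smul_sum, smul_smul]
  exact CoeffTendsto.sum _ fun mu hmu =>
    CoeffTendsto.smul_seq (tendsto_sigma hq0 hq1 hc hd (mem_subdiagrams.mp hmu)) (hI mu)

theorem ascFun_bot (hq0 : 0 < q) (c d : ℂ) : ascFun q c d ⊥ = 1 := by
  rw [ascFun, subdiagrams_bot, Finset.sum_singleton, sigmaASC_self, IA_bot hq0]
  simp

theorem exists_tendsto_ascMinor (hq0 : 0 < q) (hq1 : q < 1) {c d : ℂ} (hc : c ≠ 0) (hd : d ≠ 0)
    {lam mu : YoungDiagram} (hmu : mu ≤ lam) :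
    ∃ l, Filter.Tendsto (ascMinor q (-c / d) lam mu) Filter.atTop (𝓝 l) := by
  refine ⟨_, ((tendsto_sigma hq0 hq1 hc hd hmu).const_mul (c ^ (lam.card : ℤ))).congr fun N => ?_⟩
  rw [← mul_assoc, ← zpow_add₀ hc, add_neg_cancel, zpow_zero, one_mul]
  rfl

open scoped Classical in
/-- The moment functional: the limit of the finite-variable functionals. -/
theorem exists_limit_functional (hq0 : 0 < q) (hq1 : q < 1) {c d : ℂ} (hc : c ≠ 0)
    (hd : d ≠ 0) : ∃ E : SymFun →ₗ[ℂ] ℂ, ∀ lam mu : YoungDiagram,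
      E (ascFun q c d lam * ascFun q c d mu) = if lam = mu then hASC q c d lam else 0 := by
  have hq : (q : ℂ) ≠ 0 := by exact_mod_cast hq0.ne'
  have ht : -c / d ≠ 0 := div_ne_zero (neg_ne_zero.mpr hc) hd
  choose E hE using exists_ascSeq_orthogonal hq0 hq1 ht
  -- Since `ascSeq` at `⊥` is 1, this value is an entry of the orthogonality relation: zero, or the
  -- convergent `rowRatio` when `λ = ⊥`.
  have hY : ∀ lam, ∃ l, Filter.Tendsto (fun N => E N (ascSeq q (-c / d) lam N))
      Filter.atTop (𝓝 l) := by
    intro lam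
    refine ⟨if lam = ⊥ then 1 else 0, ?_⟩
    have h1 : Filter.Tendsto (fun N => if lam = ⊥ then rowRatio q N lam else 0) Filter.atTop
        (𝓝 (if lam = ⊥ then 1 else 0)) := by
      split_ifs
      · exact tendsto_rowRatio hq0 hq1 lam
      · exact tendsto_const_nhds
    refine h1.congr' ?_
    filter_upwards [Filter.eventually_ge_atTop (len lam)] with N hN
    have h2 := hE N lam ⊥ hN (by simp)
    rw [ascSeq_bot hq0 hq1 ht, mul_one] at h2
    rw [h2]
    split_ifs with h
    · subst h
      simp [coContent]
    · rfl
  -- Convergence is transferred from Al-Salam--Carlitz to interpolation to Schur functions; the two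
  -- arrays vary with `N` but are unitriangular with convergent entries.
  have hI := exists_tendsto_of_triangular (x := fun lam N => E N (interpSeq q lam N))
    (fun lam mu h => exists_tendsto_ascMinor hq0 hq1 hc hd h)
    (fun lam N => ascMinor_self hq0 hq1 ht lam N) hY
    (fun lam => Filter.Eventually.of_forall fun N => by
      simp only [ascSeq, map_sum, map_smul, smul_eq_mul])
  have hS := exists_tendsto_of_triangular (x := fun lam N => E N (schur lam))
    (fun lam mu h => exists_tendsto_shiftedMinor_newtonCoeff hq0 hq1 h)
    (fun lam N => interpCoeff_self lam N) hI
    (fun lam => Filter.Eventually.of_forall fun N => by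
      simp only [interpSeq, map_sum, map_smul, smul_eq_mul]
      rfl)
  have hF : ∀ F : SymFun, ∃ l, Filter.Tendsto (fun N => E N F) Filter.atTop (𝓝 l) := by
    intro F
    have hmem : F ∈ Submodule.span ℂ (Set.range schur) := span_schur ▸ Submodule.mem_top
    induction hmem using Submodule.span_induction with
    | mem x hx =>
      obtain ⟨lam, rfl⟩ := hx
      exact hS lam
    | zero => exact ⟨0, by simp⟩
    | add x y _ _ hx hy =>
      obtain ⟨a, ha⟩ := hx
      obtain ⟨b, hb⟩ := hy
      exact ⟨a + b, by simpa only [map_add] using ha.add hb⟩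
    | smul a x _ hx =>
      obtain ⟨b, hb⟩ := hx
      exact ⟨a * b, by simpa only [map_smul, smul_eq_mul] using hb.const_mul a⟩
  choose E₀ hE₀ using hF
  refine ⟨linearMapOfTendsto E₀ E (tendsto_pi_nhds.mpr hE₀), fun lam mu => ?_⟩
  have h1 := ((coeffTendsto_ascSeq hq0 hq1 hc hd lam).mul
    (coeffTendsto_ascSeq hq0 hq1 hc hd mu)).map
      (E₀ := linearMapOfTendsto E₀ E (tendsto_pi_nhds.mpr hE₀)) hE₀
  refine tendsto_nhds_unique h1 ?_
  have h2 : Filter.Tendsto (fun N => if lam = mu then hASC q c d lam * rowRatio q N lam else 0)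
      Filter.atTop (𝓝 (if lam = mu then hASC q c d lam else 0)) := by
    split_ifs
    · simpa using (tendsto_rowRatio hq0 hq1 lam).const_mul (hASC q c d lam)
    · exact tendsto_const_nhds
  refine h2.congr' ?_
  filter_upwards [Filter.eventually_ge_atTop (len lam), Filter.eventually_ge_atTop (len mu)]
    with N hN hN'
  rw [smul_mul_smul_comm, map_smul, hE N lam mu hN hN', smul_eq_mul]
  split_ifs with h
  · subst h
    rw [hASC, zpow_mul, zpow_comm, zpow_neg, zpow_natCast]
    -- The two normalizations contribute `c^(-2|λ|)`, and `c⁻² · c/(dq) = 1/(cdq)`.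
    have h3 : -(-c / d) / (q : ℂ) = c / (d * q) := by field_simp
    have h4 : ((q : ℂ) ^ coContent lam) ^ 2 =
        ((q : ℂ) ^ ((nStat lam : ℤ) - nStat lam.transpose)) ^ (2 : ℤ) := by
      rw [coContent]
      norm_cast
    rw [h3, h4, div_pow, mul_pow, mul_pow, mul_pow]
    field_simp
  · rw [mul_zero]

/-! ### Linear independence and spanning -/

theorem hASC_ne_zero (hq0 : 0 < q) {c d : ℂ} (hc : c ≠ 0) (hd : d ≠ 0) (lam : YoungDiagram) :
    hASC q c d lam ≠ 0 := by
  have hq : (q : ℂ) ≠ 0 := by exact_mod_cast hq0.ne'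
  exact div_ne_zero (zpow_ne_zero _ hq) (pow_ne_zero _ (mul_ne_zero (mul_ne_zero hc hd) hq))

/-- Pairing a vanishing combination with one member isolates its coefficient times a nonzero norm.
-/
theorem linearIndependent_ascFun (hq0 : 0 < q) (hq1 : q < 1) {c d : ℂ} (hc : c ≠ 0)
    (hd : d ≠ 0) : LinearIndependent ℂ (ascFun q c d) := by
  classical
  obtain ⟨E, hE⟩ := exists_limit_functional hq0 hq1 hc hd
  rw [linearIndependent_iff']
  intro s g hg mu hmu
  have h1 := congrArg (fun F => E (F * ascFun q c d mu)) hg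
  simp only [Finset.sum_mul, smul_mul_assoc, map_sum, map_smul, hE, zero_mul, map_zero,
    smul_eq_mul, mul_ite, mul_zero] at h1
  rw [Finset.sum_ite_eq' s mu, if_pos hmu] at h1
  exact (mul_eq_zero.mp h1).resolve_right (hASC_ne_zero hq0 hc hd mu)

theorem span_ascFun (hq0 : 0 < q) (hq1 : q < 1) {c d : ℂ} (hc : c ≠ 0) :
    Submodule.span ℂ (Set.range (ascFun q c d)) = ⊤ := by
  obtain ⟨D, hD, hIA, -⟩ := exists_interpCoeff_limit hq0 hq1
  have h1 : ∀ lam, IA q lam ∈ Submodule.span ℂ (Set.range (ascFun q c d)) :=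
    mem_span_of_triangular (fun lam => by rw [sigmaASC_self]; exact zpow_ne_zero _ hc)
      fun lam => rfl
  have h2 : ∀ lam, schur lam ∈ Submodule.span ℂ (Set.range (IA q)) :=
    mem_span_of_triangular (fun lam => by rw [hD]; exact one_ne_zero) hIA
  rw [eq_top_iff, ← span_schur, Submodule.span_le, Set.range_subset_iff]
  exact fun lam => Submodule.span_le.mpr (Set.range_subset_iff.mpr h1) (h2 lam)

end

/-! ### Dilations -/

theorem coeff_dilate (c : ℂ) (F : SymFun) (m : ℕ →₀ ℕ) :
    MvPowerSeries.coeff m (dilate c F).1 = c ^ m.degree * MvPowerSeries.coeff m F.1 := by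
  show MvPowerSeries.coeff m (MvPowerSeries.rescale (fun _ => c) F.1) = _
  rw [MvPowerSeries.coeff_rescale, Finsupp.prod, Finset.prod_pow_eq_pow_sum]
  rfl

/-- Dilation of the variables by a nonzero number, as an automorphism. -/
def dilateEquiv (c : ℂ) (hc : c ≠ 0) : SymFun ≃ₗ[ℂ] SymFun where
  toFun := dilate c
  map_add' F G := Subtype.ext (map_add (MvPowerSeries.rescale fun _ => c) F.1 G.1)
  map_smul' a F := by
    apply Subtype.ext
    ext m
    show _ = MvPowerSeries.coeff m (a • (dilate c F).1)
    rw [map_smul, coeff_dilate, coeff_dilate]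
    show _ * MvPowerSeries.coeff m (a • F.1) = _
    rw [map_smul, smul_eq_mul, smul_eq_mul, mul_left_comm]
  invFun := dilate c⁻¹
  left_inv F := by
    apply Subtype.ext
    ext m
    rw [coeff_dilate, coeff_dilate, ← mul_assoc, ← mul_pow, inv_mul_cancel₀ hc, one_pow, one_mul]
  right_inv F := by
    apply Subtype.ext
    ext m
    rw [coeff_dilate, coeff_dilate, ← mul_assoc, ← mul_pow, mul_inv_cancel₀ hc, one_pow, one_mul]

theorem dilate_mul (c : ℂ) (F G : SymFun) : dilate c (F * G) = dilate c F * dilate c G :=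
  Subtype.ext (map_mul (MvPowerSeries.rescale fun _ => c) F.1 G.1)

theorem dilate_one (c : ℂ) : dilate c 1 = 1 :=
  Subtype.ext (map_one (MvPowerSeries.rescale fun _ => c))

theorem PhiASC_eq_dilate (q : ℝ) {c : ℂ} (hc : c ≠ 0) (d : ℂ) (lam : YoungDiagram) :
    PhiASC q c d lam = dilate c (ascFun q c d lam) := by
  have h : dilate c (ascFun q c d lam) = dilateEquiv c hc (ascFun q c d lam) := rfl
  rw [h, ascFun, map_sum]
  simp only [map_smul]
  rfl

theorem Admissible.ne_zero {q : ℝ} {c d : ℂ} (h : Admissible q c d) : c ≠ 0 ∧ d ≠ 0 := by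
  rcases h with ⟨rfl, h⟩ | ⟨c', d', rfl, rfl, h, -⟩
  · have hc : c ≠ 0 := fun h0 => h (by simp [h0])
    exact ⟨hc, by simpa using hc⟩
  · have h1 : c' ≠ 0 ∧ d' ≠ 0 := by
      rcases h with h | h
      · exact ⟨h.1.ne', h.2.ne'⟩
      · exact ⟨h.1.ne, h.2.ne⟩
    exact_mod_cast h1

end ASCSym

end

/-! ### The Al-Salam--Carlitz basis and its orthogonality -/

theorem mainTheorem10 (q : ℝ) (hq0 : 0 < q) (hq1 : q < 1) (c d : ℂ)
    (hcd : ASCSym.Admissible q c d) :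
    (∀ mu : YoungDiagram, ASCSym.ConvergesTo (ASCSym.interpA q mu) (ASCSym.IA q mu)) ∧
    ASCSym.PhiASC q c d ⊥ = 1 ∧
    ∃ b : Module.Basis YoungDiagram ℂ ASCSym.SymFun,
      (∀ lam : YoungDiagram, b lam = ASCSym.PhiASC q c d lam) ∧
      (∀ lam mu : YoungDiagram, lam ≠ mu →
        ASCSym.formalInner b (ASCSym.PhiASC q c d lam) (ASCSym.PhiASC q c d mu) = 0) ∧
      (∀ lam : YoungDiagram,
        ASCSym.formalInner b (ASCSym.PhiASC q c d lam) (ASCSym.PhiASC q c d lam) =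
          ASCSym.hASC q c d lam) := by
  classical
  obtain ⟨hc, hd⟩ := hcd.ne_zero
  obtain ⟨D, -, -, hI⟩ := ASCSym.exists_interpCoeff_limit hq0 hq1
  obtain ⟨E, hE⟩ := ASCSym.exists_limit_functional hq0 hq1 hc hd
  let b₀ : Module.Basis YoungDiagram ℂ ASCSym.SymFun :=
    Module.Basis.mk (ASCSym.linearIndependent_ascFun hq0 hq1 hc hd)
      (ASCSym.span_ascFun hq0 hq1 hc).ge
  have hb₀ : ∀ lam, b₀ lam = ASCSym.ascFun q c d lam := fun lam => Module.Basis.mk_apply _ _ _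
  -- The pairing of a basis element with `ascFun` at `⊥`, which is 1, shows that the limit
  -- functional takes the values defining the moment functional; in particular `h_∅ = 1`.
  have hcoord : b₀.coord ⊥ = E := by
    refine b₀.ext fun lam => ?_
    have h := hE lam ⊥
    rw [ASCSym.ascFun_bot hq0, mul_one] at h
    rw [Module.Basis.coord_apply, Module.Basis.repr_self, Finsupp.single_apply, hb₀, h]
    split_ifs with h0
    · subst h0
      simp [ASCSym.hASC]
    · rfl
  -- Dilation is multiplicative, so the product of two dilated functions is the dilation of their
  -- product, and its coordinate in the dilated basis is the coordinate of the undilated product.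
  have hinner : ∀ lam mu, ASCSym.formalInner (b₀.map (ASCSym.dilateEquiv c hc))
      (ASCSym.PhiASC q c d lam) (ASCSym.PhiASC q c d mu) =
      if lam = mu then ASCSym.hASC q c d lam else 0 := by
    intro lam mu
    rw [← hE, ← hcoord, ASCSym.formalInner, ASCSym.momentFunctional,
      ASCSym.PhiASC_eq_dilate q hc, ASCSym.PhiASC_eq_dilate q hc, ← ASCSym.dilate_mul]
    rw [Module.Basis.coord_apply, Module.Basis.coord_apply, Module.Basis.map_repr,
      LinearEquiv.trans_apply]
    congr 2
    exact (ASCSym.dilateEquiv c hc).symm_apply_apply _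
  refine ⟨fun mu => ASCSym.convergesTo_interpA hq0 (hI mu), ?_,
    b₀.map (ASCSym.dilateEquiv c hc), fun lam => ?_, fun lam mu h => ?_, fun lam => ?_⟩
  · rw [ASCSym.PhiASC_eq_dilate q hc, ASCSym.ascFun_bot hq0, ASCSym.dilate_one]
  · rw [Module.Basis.map_apply, hb₀, ASCSym.PhiASC_eq_dilate q hc]
    rfl
  · rw [hinner, if_neg h]
  · rw [hinner, if_pos rfl]
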